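/- Let $B>0$. Let $(\lambda)_k=\lambda(\lambda+1)\cdots(\lambda+k-1)$ be the Pochhammer symbol, let $${}_1F_3(a;b_1,b_2,b_3;\nu)=\sum_{k=0}^{\infty}\frac{(a)_k}{(b_1)_k(b_2)_k(b_3)_k}\,\frac{\nu^k}{k!},$$ and for $u\in\mathbb{R}$ put $$z_1(u)={}_1F_3\left(-\tfrac14;\tfrac14,\tfrac12,\tfrac34;\tfrac{u^4}{256}\right),\quad z_2(u)=u,\quad z_3(u)=u^2\,{}_1F_3\left(\tfrac14;\tfrac34,\tfrac54,\tfrac32;\tfrac{u^4}{256}\right),\quad z_4(u)=u^3\,{}_1F_3\left(\tfrac12;\tfrac54,\tfrac32,\tfrac74;\tfrac{u^4}{256}\right).$$ For $t>0$ and $x\in\mathbb{R}$ define $y_1,\dots,y_4$ by $$\begin{bmatrix} y_1(t,x)\\ y_2(t,x)\\ y_3(t,x)\\ y_4(t,x)\end{bmatrix}=(Bt)^{1/4}\begin{bmatrix}0&\frac1{\sqrt2}&-1&\frac1{\sqrt2}\\ 1&-\frac1{\sqrt2}&0&\frac1{\sqrt2}\\ 0&\frac1{\sqrt2}&1&\frac1{\sqrt2}\\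 1&\frac1{\sqrt2}&0&-\frac1{\sqrt2}\end{bmatrix}\begin{bmatrix}\frac{1}{\Gamma(5/4)}z_1(u)\\ \frac1{\Gamma(1)}z_2(u)\\ \frac1{2\Gamma(3/4)}z_3(u)\\ \frac1{6\Gamma(1/2)}z_4(u)\end{bmatrix},\qquad u=\frac{x}{(Bt)^{1/4}}.$$ Then $y_1,\dots,y_4$ form a fundamental set of self-similar solutions of Mullins' equation $$y_t+B\,y_{xxxx}=0,\qquad x\in\mathbb{R}\setminus\{0\},\ t>0.$$ That is: each $y_i$ is a classical solution (differentiable in $t$, four times continuously differentiable in $x$) of the self-similar form $y(t,x)=(Bt)^{1/4}Z\big(x/(Bt)^{1/4}\big)$; the four functions are linearly independent over $\mathbb{R}$ on the domain $t>0$, $x\neq0$, and also on each of the domains $t>0,\ x>0$ and $t>0,\ x<0$; and on each of the latter two domains every classical solution of this self-similar form is a real linear combination of $y_1,\dots,y_4$. Moreover, for every $t>0$, $$\lim_{x\to\infty}y_1(t,x)=\lim_{x\to\infty}y_2(t,x)=0,\qquad \lim_{x\to-\infty}y_3(t,x)=\lim_{x\to-\infty}y_4(t,x)=0,$$ $$\lim_{x\to-\infty}y_1(t,x)=\lim_{x\to-\infty}y_2(t,x)=-\infty,\qquad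 \lim_{x\to\infty}y_3(t,x)=\infty,\quad \lim_{x\to\infty}y_4(t,x)=-\infty,$$ and furthermore $$\lim_{t\to0^+}y_1(t,x)=\lim_{t\to0^+}y_2(t,x)=0\quad\text{for every }x>0,\qquad \lim_{t\to0^+}y_3(t,x)=\lim_{t\to0^+}y_4(t,x)=0\quad\text{for every }x<0.$$ -/

import Mathlib

open Set Filter Topology

noncomputable section

namespace Mullins

/-- The Pochhammer symbol `(a)_k = a (a + 1) ⋯ (a + k - 1)`. -/
def poch (a : ℝ) (k : ℕ) : ℝ := (ascPochhammer ℝ k).eval a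

/-- The generalized hypergeometric function `₁F₃(a; b₁, b₂, b₃; ν)`. -/
def hyp13 (a b₁ b₂ b₃ ν : ℝ) : ℝ :=
  ∑' k : ℕ, poch a k / (poch b₁ k * poch b₂ k * poch b₃ k) * (ν ^ k / (k.factorial : ℝ))

def z₁ (u : ℝ) : ℝ := hyp13 (-1 / 4) (1 / 4) (1 / 2) (3 / 4) (u ^ 4 / 256)

def z₂ (u : ℝ) : ℝ := u

def z₃ (u : ℝ) : ℝ := u ^ 2 * hyp13 (1 / 4) (3 / 4) (5 / 4) (3 / 2) (u ^ 4 / 256)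

def z₄ (u : ℝ) : ℝ := u ^ 3 * hyp13 (1 / 2) (5 / 4) (3 / 2) (7 / 4) (u ^ 4 / 256)

/-- The coefficient matrix. -/
def D : Matrix (Fin 4) (Fin 4) ℝ :=
  !![0, 1 / √2, -1, 1 / √2;
     1, -(1 / √2), 0, 1 / √2;
     0, 1 / √2, 1, 1 / √2;
     1, 1 / √2, 0, -(1 / √2)]

/-- The vector of the Gamma-normalized functions `z₁, …, z₄`. -/
def w (u : ℝ) : Fin 4 → ℝ :=
  ![1 / Real.Gamma (5 / 4) * z₁ u,
    1 / Real.Gamma 1 * z₂ u,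
    1 / (2 * Real.Gamma (3 / 4)) * z₃ u,
    1 / (6 * Real.Gamma (1 / 2)) * z₄ u]

/-- `y B 0, y B 1, y B 2, y B 3` are the functions `y₁, y₂, y₃, y₄` of `(t, x)`. -/
def y (B : ℝ) (i : Fin 4) (t x : ℝ) : ℝ :=
  (B * t) ^ (1 / 4 : ℝ) * (D.mulVec (w (x / (B * t) ^ (1 / 4 : ℝ)))) i

/-- `f` is a classical solution of `f_t + B f_xxxx = 0` for `t > 0` and `x` in the open set `S`. -/
def IsSolution (B : ℝ) (S : Set ℝ) (f : ℝ → ℝ → ℝ) : Prop :=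
  (∀ t, 0 < t → ContDiffOn ℝ 4 (fun x => f t x) S) ∧
  ∀ t, 0 < t → ∀ x ∈ S,
    DifferentiableAt ℝ (fun s => f s x) t ∧
    deriv (fun s => f s x) t + B * iteratedDeriv 4 (fun ξ => f t ξ) x = 0

/-- `f(t, x) = (B t)^{1/4} Z(x / (B t)^{1/4})` for `t > 0` and `x ∈ S`, for some profile `Z`. -/
def IsSelfSimilar (B : ℝ) (S : Set ℝ) (f : ℝ → ℝ → ℝ) : Prop :=
  ∃ Z : ℝ → ℝ, ∀ t, 0 < t → ∀ x ∈ S,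
    f t x = (B * t) ^ (1 / 4 : ℝ) * Z (x / (B * t) ^ (1 / 4 : ℝ))

/-- Linear independence over `ℝ` of functions of `(t, x)` on the domain `(0, ∞) × S`. -/
def LinIndepOn (S : Set ℝ) (F : Fin 4 → ℝ → ℝ → ℝ) : Prop :=
  LinearIndependent ℝ fun i : Fin 4 => (Ioi (0 : ℝ) ×ˢ S).domRestrict fun p : ℝ × ℝ => F i p.1 p.2

/-- `F` is a fundamental set (a basis) of the self-similar solutions on `(0, ∞) × S`. -/
def IsFundamentalSet (B : ℝ) (S : Set ℝ) (F : Fin 4 → ℝ → ℝ → ℝ) : Prop :=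
  (∀ i, IsSolution B S (F i) ∧ IsSelfSimilar B S (F i)) ∧
  LinIndepOn S F ∧
  ∀ f : ℝ → ℝ → ℝ, IsSolution B S f → IsSelfSimilar B S f →
    ∃ c : Fin 4 → ℝ, ∀ t, 0 < t → ∀ x ∈ S, f t x = ∑ i, c i * F i t x

end Mullins

end

/-! With `q = (B t)^(1/4)`, a function `q Z(x/q)` solves the equation exactly when `Z⁗ = (u Z' -
Z)/4`. For `Z = ∑ aₙ uⁿ/n!` this is the recurrence `aₙ₊₄ = (n-1)/4 · aₙ`, whose solutions are all
entire and form a four-dimensional space `profile v`, indexed by the initial data `v` at `0`. Each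
`zᵢ` is a multiple of the profile with a single nonzero datum, and the matrix of initial data of
`y₁, …, y₄` is invertible. On a half-line, where `0` is only a boundary point, completeness follows
because the map from data at `0` to the jet at an interior point is injective, hence bijective
(`exists_eqOn_profile`).

The decay at `+∞` is the delicate part, since it comes from cancellation between growing series. Let
`k(s) = (1 - exp(-s⁴))/s²` and let `h = ∑ cₙ sⁿ/n!` have 4-periodic coefficients with `c₀ = 1`, `c₁
= 0`. Termwise integration gives (`integral_comp_mul_kernel`) `∫₀^∞ h(us) k(s) ds = u ∫₀^∞ (h(s) -
1)/s² ds - (1/4) ∑ cₙ Γ((n-1)/4) uⁿ/n!`, and the functional equation of `Γ` makes the last series a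
profile. For `h = cos` and `h = exp(-·) + sin` the left side tends to `0` by the Riemann–Lebesgue
lemma and dominated convergence, while the constant integrals are `-π/2` and `0`. Up to a factor the
two resulting decaying profiles are the difference and the sum of those of `y₁` and `y₂`.

Growth of `y₃, y₄` at `+∞` is read off from coefficient signs, and the reflection `u ↦ -u` supplies
the behaviour at `-∞`. As `t → 0⁺`, `x/q` tends to `±∞` and `q` to `0`, so those limits follow from
decay of the profiles. -/

namespace Mullins

/-! ### Entire series and termwise differentiation -/

/-- The exponential generating function `∑ aₙ uⁿ / n!`. -/
noncomputable def egf (a : ℕ → ℝ) (u : ℝ) : ℝ := ∑' n : ℕ, a n * (u ^ n / (n.factorial : ℝ))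

/-- The exponential generating function of `a` converges on the whole real line. -/
def IsEntire (a : ℕ → ℝ) : Prop := ∀ r : ℝ, Summable fun n : ℕ => a n * (r ^ n / (n.factorial : ℝ))

theorem IsEntire.shift {a : ℕ → ℝ} (h : IsEntire a) : IsEntire fun n => a (n + 1) := by
  intro r
  set R : ℝ := max |r| 1
  have hR : 1 ≤ R := le_max_right _ _
  have hs := ((summable_nat_add_iff 1).2 (h (2 * R))).abs
  refine Summable.of_norm_bounded hs fun n => ?_
  rw [Real.norm_eq_abs, abs_mul, abs_mul]
  refine mul_le_mul_of_nonneg_left ?_ (abs_nonneg _)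
  rw [abs_div, abs_div, abs_pow, abs_pow, Nat.abs_cast, Nat.abs_cast, Nat.factorial_succ,
    abs_of_nonneg (by positivity : 0 ≤ 2 * R)]
  push_cast
  rw [div_le_div_iff₀ (by positivity) (by positivity)]
  have h1 : |r| ^ n ≤ R ^ (n + 1) :=
    (pow_le_pow_left₀ (abs_nonneg r) (le_max_left _ _) n).trans (pow_le_pow_right₀ hR n.le_succ)
  -- Doubling the radius absorbs the factor `n + 1` by which the factorials differ.
  have h2 : ((n : ℝ) + 1) ≤ 2 ^ (n + 1) := by
    have := (Nat.lt_two_pow_self (n := n + 1)).le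
    exact_mod_cast this
  calc |r| ^ n * (((n : ℝ) + 1) * n.factorial)
      ≤ R ^ (n + 1) * (2 ^ (n + 1) * n.factorial) := by gcongr
    _ = (2 * R) ^ (n + 1) * n.factorial := by rw [mul_pow]; ring

theorem IsEntire.shift_iterate {a : ℕ → ℝ} (h : IsEntire a) (k : ℕ) :
    IsEntire fun n => a (n + k) := by
  induction k with
  | zero => exact h
  | succ k ih =>
    have := ih.shift
    simpa only [add_assoc, add_comm 1 k] using this

theorem egf_zero (a : ℕ → ℝ) : egf a 0 = a 0 := by
  rw [egf, tsum_eq_single 0]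
  · simp
  · intro n hn
    simp [hn]

theorem hasDerivAt_egf {a : ℕ → ℝ} (h : IsEntire a) (u : ℝ) :
    HasDerivAt (egf a) (egf (fun n => a (n + 1)) u) u := by
  have key : ∀ (n : ℕ) (y : ℝ), HasDerivAt (fun z : ℝ => a (n + 1) * (z ^ (n + 1) / ((n + 1).factorial : ℝ)))
      (a (n + 1) * (y ^ n / (n.factorial : ℝ))) y := by
    intro n y
    have := ((hasDerivAt_pow (n + 1) y).div_const ((n + 1).factorial : ℝ)).const_mul (a (n + 1))
    refine this.congr_deriv ?_
    rw [Nat.factorial_succ]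
    push_cast
    have : (n.factorial : ℝ) ≠ 0 := by positivity
    have h2 : (n : ℝ) + 1 ≠ 0 := by positivity
    field_simp
  have hR : 0 < |u| + 1 := by positivity
  have h0 := h.shift (|u| + 1)
  have main : HasDerivAt (fun z => ∑' n : ℕ, a (n + 1) * (z ^ (n + 1) / ((n + 1).factorial : ℝ)))
      (∑' n : ℕ, a (n + 1) * (u ^ n / (n.factorial : ℝ))) u := by
    refine hasDerivAt_tsum_of_isPreconnected (t := Metric.ball 0 (|u| + 1)) (y₀ := 0) h0.abs
      Metric.isOpen_ball (convex_ball _ _).isPreconnected (fun n y _ => key n y) ?_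
      (Metric.mem_ball_self hR) ((summable_nat_add_iff 1).2 (h 0)) (by simp)
    intro n y hy
    have hy' : |y| ≤ |u| + 1 := by simpa using (mem_ball_zero_iff.1 hy).le
    rw [Real.norm_eq_abs, abs_mul, abs_mul]
    refine mul_le_mul_of_nonneg_left ?_ (abs_nonneg _)
    rw [abs_div, abs_div, abs_pow, abs_pow, abs_of_pos hR]
    gcongr
  -- With the constant term split off, every remaining term differentiates to the term of the
  -- shifted series with no vanishing leading term.
  have hE : egf a = fun z => a 0 + ∑' n : ℕ, a (n + 1) * (z ^ (n + 1) / ((n + 1).factorial : ℝ)) := by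
    funext z
    rw [egf, (h z).tsum_eq_zero_add]
    simp
  rw [hE]
  exact main.const_add _

theorem deriv_egf {a : ℕ → ℝ} (h : IsEntire a) : deriv (egf a) = egf fun n => a (n + 1) :=
  funext fun u => (hasDerivAt_egf h u).deriv

theorem iteratedDeriv_egf (k : ℕ) {a : ℕ → ℝ} (h : IsEntire a) :
    iteratedDeriv k (egf a) = egf fun n => a (n + k) := by
  induction k with
  | zero => simp
  | succ k ih =>
    rw [iteratedDeriv_succ, ih, deriv_egf (h.shift_iterate k)]
    simp only [add_assoc, add_comm 1 k]

theorem contDiff_egf (k : ℕ) {a : ℕ → ℝ} (h : IsEntire a) : ContDiff ℝ k (egf a) := by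
  induction k generalizing a with
  | zero =>
    exact contDiff_zero.2 (continuous_iff_continuousAt.2 fun u => (hasDerivAt_egf h u).continuousAt)
  | succ k ih =>
    push_cast
    refine contDiff_succ_iff_deriv.2 ⟨fun u => (hasDerivAt_egf h u).differentiableAt, ?_, ?_⟩
    · intro hk
      exact absurd hk (by simp)
    · rw [deriv_egf h]
      exact ih h.shift

/-- Coefficients satisfying the recurrence of `Z⁽⁴⁾ = (u Z⁽¹⁾ - Z) / 4` have rapid decay. -/
theorem isEntire_of_recurrence {a : ℕ → ℝ} (ha : ∀ n : ℕ, a (n + 4) = ((n : ℝ) - 1) / 4 * a n) :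
    IsEntire a := by
  intro r
  set K : ℝ := 2 * max |r| 1 with hK
  have hm : 1 ≤ max |r| 1 := le_max_right _ _
  have hK1 : 1 ≤ K := by rw [hK]; linarith
  have hK0 : 0 < K := by linarith
  obtain ⟨N, hN⟩ := exists_nat_ge (K ^ 4)
  set b : ℕ → ℝ := fun n => |a n| * (K ^ n / (n.factorial : ℝ)) with hb
  have hb0 : ∀ n, 0 ≤ b n := fun n => by simp only [hb]; positivity
  -- Four steps gain four linear factors from the factorial against one from the recurrence, so the
  -- terms at radius `K` are eventually nonincreasing mod 4, hence bounded. Since `K ≥ 2|r|`, the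
  -- terms at `r` are then dominated by a geometric series.
  have hstep : ∀ n, N ≤ n → b (n + 4) ≤ b n := by
    intro n hn
    have hn' : K ^ 4 ≤ n := hN.trans (by exact_mod_cast hn)
    have hf : ((n + 4).factorial : ℝ) = ((n : ℝ) + 4) * (n + 3) * (n + 2) * (n + 1) * n.factorial := by
      simp only [Nat.factorial_succ]
      push_cast
      ring
    have hn1 : |((n : ℝ) - 1) / 4| ≤ n + 1 := by
      have : (0 : ℝ) ≤ n := Nat.cast_nonneg n
      rw [abs_le]
      constructor <;> linarith
    have hfac : (0 : ℝ) < n.factorial := by positivity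
    have hnn : (0 : ℝ) ≤ n := Nat.cast_nonneg n
    simp only [hb, ha, abs_mul, hf]
    have e : K ^ (n + 4) / (((n : ℝ) + 4) * (n + 3) * (n + 2) * (n + 1) * n.factorial)
        = K ^ n / n.factorial * (K ^ 4 / (((n : ℝ) + 4) * (n + 3) * (n + 2) * (n + 1))) := by
      rw [pow_add]
      field_simp
    rw [e]
    have h1 : |((n : ℝ) - 1) / 4| * (K ^ 4 / (((n : ℝ) + 4) * (n + 3) * (n + 2) * (n + 1))) ≤ 1 := by
      rw [← mul_div_assoc, div_le_one (by positivity)]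
      calc |((n : ℝ) - 1) / 4| * K ^ 4 ≤ (n + 1) * n := by gcongr
        _ ≤ ((n : ℝ) + 4) * (n + 3) * (n + 2) * (n + 1) := by
          have : (n : ℝ) ≤ ((n : ℝ) + 4) * (n + 3) * (n + 2) := by
            nlinarith [mul_nonneg hnn hnn, mul_nonneg (mul_nonneg hnn hnn) hnn]
          nlinarith
    calc |((n : ℝ) - 1) / 4| * |a n| * (K ^ n / n.factorial
          * (K ^ 4 / (((n : ℝ) + 4) * (n + 3) * (n + 2) * (n + 1))))
        = |((n : ℝ) - 1) / 4| * (K ^ 4 / (((n : ℝ) + 4) * (n + 3) * (n + 2) * (n + 1)))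
          * (|a n| * (K ^ n / n.factorial)) := by ring
      _ ≤ 1 * (|a n| * (K ^ n / n.factorial)) := by gcongr
      _ = _ := one_mul _
  set M : ℝ := ∑ i ∈ Finset.range (N + 4), b i
  have hbound : ∀ n, b n ≤ M := by
    intro n
    induction n using Nat.strong_induction_on with
    | _ n ih =>
      by_cases hn : n < N + 4
      · exact Finset.single_le_sum (fun i _ => hb0 i) (Finset.mem_range.2 hn)
      · obtain ⟨m, rfl⟩ : ∃ m, n = m + 4 := ⟨n - 4, by omega⟩
        exact (hstep m (by omega)).trans (ih m (by omega))
  refine Summable.of_norm_bounded ((summable_geometric_two).mul_left M) fun n => ?_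
  have hr : |r| ≤ K / 2 := by
    rw [hK, mul_div_cancel_left₀ _ (two_ne_zero)]
    exact le_max_left _ _
  rw [Real.norm_eq_abs, abs_mul, abs_div, abs_pow, Nat.abs_cast]
  calc |a n| * (|r| ^ n / n.factorial) ≤ |a n| * ((K / 2) ^ n / n.factorial) := by gcongr
    _ = b n * (1 / 2) ^ n := by simp only [hb, div_pow, one_pow]; ring
    _ ≤ M * (1 / 2) ^ n := by gcongr; exact hbound n

/-! ### Entire solutions of the profile equation -/

/-- The Taylor coefficients (times `n!`) of the solution of `Z⁽⁴⁾ = (u Z⁽¹⁾ - Z) / 4` with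
initial data `v` at `0`. -/
noncomputable def coef (v : Fin 4 → ℝ) : ℕ → ℝ
  | 0 => v 0
  | 1 => v 1
  | 2 => v 2
  | 3 => v 3
  | n + 4 => ((n : ℝ) - 1) / 4 * coef v n

theorem coef_add_four (v : Fin 4 → ℝ) (n : ℕ) : coef v (n + 4) = ((n : ℝ) - 1) / 4 * coef v n := by
  rw [coef]

theorem eq_coef {a : ℕ → ℝ} (ha : ∀ n : ℕ, a (n + 4) = ((n : ℝ) - 1) / 4 * a n) :
    ∀ n, a n = coef ![a 0, a 1, a 2, a 3] n
  | 0 => by simp [coef]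
  | 1 => by simp [coef]
  | 2 => by simp [coef]
  | 3 => by simp [coef]
  | n + 4 => by rw [ha, coef, ← eq_coef ha n]

theorem coef_add (v w : Fin 4 → ℝ) : ∀ n, coef (v + w) n = coef v n + coef w n
  | 0 => by simp [coef]
  | 1 => by simp [coef]
  | 2 => by simp [coef]
  | 3 => by simp [coef]
  | n + 4 => by simp only [coef_add_four, coef_add v w n]; ring

theorem coef_smul (c : ℝ) (v : Fin 4 → ℝ) : ∀ n, coef (c • v) n = c * coef v n
  | 0 => by simp [coef]
  | 1 => by simp [coef]
  | 2 => by simp [coef]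
  | 3 => by simp [coef]
  | n + 4 => by simp only [coef_add_four, coef_smul c v n]; ring

theorem isEntire_coef (v : Fin 4 → ℝ) : IsEntire (coef v) :=
  isEntire_of_recurrence (coef_add_four v)

/-- The entire solution of `Z⁽⁴⁾ = (u Z⁽¹⁾ - Z) / 4` with initial data `v` at `0`, as a linear
function of `v`. -/
noncomputable def profile : (Fin 4 → ℝ) →ₗ[ℝ] ℝ → ℝ where
  toFun v := egf (coef v)
  map_add' v w := by
    funext u
    simp only [egf, Pi.add_apply, coef_add, add_mul]
    exact (isEntire_coef v u).tsum_add (isEntire_coef w u)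
  map_smul' c v := by
    funext u
    simp only [egf, Pi.smul_apply, coef_smul, mul_assoc, smul_eq_mul, RingHom.id_apply]
    exact tsum_mul_left

theorem profile_def (v : Fin 4 → ℝ) : profile v = egf (coef v) := rfl

theorem contDiff_profile (k : ℕ) (v : Fin 4 → ℝ) : ContDiff ℝ k (profile v) :=
  contDiff_egf k (isEntire_coef v)

theorem iteratedDeriv_profile (k : ℕ) (v : Fin 4 → ℝ) :
    iteratedDeriv k (profile v) = egf fun n => coef v (n + k) :=
  iteratedDeriv_egf k (isEntire_coef v)

theorem iteratedDeriv_profile_zero (v : Fin 4 → ℝ) (k : Fin 4) :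
    iteratedDeriv k (profile v) 0 = v k := by
  rw [iteratedDeriv_profile, egf_zero, zero_add]
  fin_cases k <;> simp [coef]

/-- The operator `u d/du` multiplies the `n`-th coefficient by `n`, so the recurrence is this
equation compared coefficientwise. -/
theorem iteratedDeriv_four_profile (v : Fin 4 → ℝ) (u : ℝ) :
    iteratedDeriv 4 (profile v) u = (u * deriv (profile v) u - profile v u) / 4 := by
  have h := isEntire_coef v
  have hd : u * deriv (profile v) u = ∑' n : ℕ, (n : ℝ) * coef v n * (u ^ n / (n.factorial : ℝ)) := by
    have e : ∀ n : ℕ, ((n + 1 : ℕ) : ℝ) * coef v (n + 1) * (u ^ (n + 1) / ((n + 1).factorial : ℝ))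
        = u * (coef v (n + 1) * (u ^ n / (n.factorial : ℝ))) := by
      intro n
      rw [Nat.factorial_succ]
      push_cast
      have h2 : (n : ℝ) + 1 ≠ 0 := by positivity
      field_simp
      ring
    have hs : Summable fun n : ℕ => (n : ℝ) * coef v n * (u ^ n / (n.factorial : ℝ)) := by
      refine (summable_nat_add_iff 1).1 ?_
      simp only [e]
      exact (h.shift u).mul_left u
    rw [hs.tsum_eq_zero_add, profile_def, deriv_egf h, egf, ← tsum_mul_left]
    simp only [e]
    simp
  have hs : Summable fun n : ℕ => (n : ℝ) * coef v n * (u ^ n / (n.factorial : ℝ)) := by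
    have h4 := ((h.shift_iterate 4 u).mul_left 4).add (h u)
    refine h4.congr fun n => ?_
    simp only [coef_add_four]
    ring
  rw [iteratedDeriv_profile, hd, profile_def, egf, egf, ← hs.tsum_sub (h u), ← tsum_div_const]
  refine tsum_congr fun n => ?_
  rw [coef_add_four]
  ring

theorem coef_eq_zero {v : Fin 4 → ℝ} {j : Fin 4} (hv : ∀ i, i ≠ j → v i = 0) :
    ∀ n : ℕ, n % 4 ≠ j → coef v n = 0
  | 0, h => by rw [coef]; exact hv 0 (fun e => h (by simp [← e]))
  | 1, h => by rw [coef]; exact hv 1 (fun e => h (by simp [← e]))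
  | 2, h => by rw [coef]; exact hv 2 (fun e => h (by simp [← e]))
  | 3, h => by rw [coef]; exact hv 3 (fun e => h (by simp [← e]))
  | n + 4, h => by rw [coef, coef_eq_zero hv n (by omega), mul_zero]

/-! ### The hypergeometric series as profiles -/

theorem poch_succ (a : ℝ) (k : ℕ) : poch a (k + 1) = poch a k * (a + k) :=
  ascPochhammer_succ_eval k a

theorem poch_pos {a : ℝ} (ha : 0 < a) (k : ℕ) : 0 < poch a k := ascPochhammer_pos k a ha

/-- A series `uʲ ₁F₃(a; b₁, b₂, b₃; u⁴ / 256)` whose parameters fit is the profile with only one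
nonzero initial datum. -/
theorem pow_mul_hyp13_eq_profile {a b₁ b₂ b₃ : ℝ} (h₁ : 0 < b₁) (h₂ : 0 < b₂) (h₃ : 0 < b₃)
    {v : Fin 4 → ℝ} {j : Fin 4} (hv : ∀ i, i ≠ j → v i = 0) (hj : v j = ((j : ℕ).factorial : ℝ))
    (hcoef : ∀ k : ℕ, (4 * (k : ℝ) + (j : ℕ) - 1) / 4 * ((b₁ + k) * (b₂ + k) * (b₃ + k) * (k + 1)) * 256 =
      (a + k) * ((4 * (k : ℝ) + (j : ℕ) + 4) * (4 * k + (j : ℕ) + 3) * (4 * k + (j : ℕ) + 2) *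
        (4 * k + (j : ℕ) + 1)))
    (u : ℝ) : u ^ (j : ℕ) * hyp13 a b₁ b₂ b₃ (u ^ 4 / 256) = profile v u := by
  -- Only indices congruent to `j` mod 4 contribute. There `hcoef` is the cross-multiplied statement
  -- that the recurrence and the hypergeometric series have the same ratio of consecutive terms.
  have hc : ∀ k : ℕ, coef v (4 * k + j) =
      poch a k / (poch b₁ k * poch b₂ k * poch b₃ k) / (256 ^ k * (k.factorial : ℝ)) *
        ((4 * k + (j : ℕ)).factorial : ℝ) := by
    intro k
    induction k with
    | zero =>
      have : coef v (j : ℕ) = v j := by fin_cases j <;> simp [coef]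
      simp [this, hj, poch]
    | succ k ih =>
      have e : 4 * (k + 1) + (j : ℕ) = (4 * k + j) + 4 := by ring
      have hf : ((4 * k + (j : ℕ) + 4).factorial : ℝ) =
          (4 * (k : ℝ) + (j : ℕ) + 4) * (4 * k + (j : ℕ) + 3) * (4 * k + (j : ℕ) + 2) *
            (4 * k + (j : ℕ) + 1) * ((4 * k + (j : ℕ)).factorial : ℝ) := by
        simp only [Nat.factorial_succ]
        push_cast
        ring
      rw [e, coef_add_four, ih, hf, poch_succ, poch_succ, poch_succ, poch_succ, Nat.factorial_succ,
        pow_succ]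
      have := poch_pos h₁ k
      have := poch_pos h₂ k
      have := poch_pos h₃ k
      have hk : (0 : ℝ) ≤ k := Nat.cast_nonneg k
      have p1 : 0 < b₁ + k := by positivity
      have p2 : 0 < b₂ + k := by positivity
      have p3 : 0 < b₃ + k := by positivity
      have hk' : (0 : ℝ) < (k : ℝ) + 1 := by positivity
      have hkf : (0 : ℝ) < k.factorial := by positivity
      push_cast
      have H := hcoef k
      rw [← eq_div_iff (by positivity), ← eq_div_iff (by positivity)] at H
      rw [H]
      field_simp
  have hinj : Function.Injective fun k : ℕ => 4 * k + (j : ℕ) := fun k l hkl => by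
    simp only at hkl
    omega
  rw [profile_def, egf, ← hinj.tsum_eq, hyp13, ← tsum_mul_left]
  · refine tsum_congr fun k => ?_
    have : (0 : ℝ) < (4 * k + (j : ℕ)).factorial := by positivity
    rw [hc, pow_add, pow_mul, div_pow]
    field_simp
  · intro n hn
    by_contra hcon
    refine hn ?_
    have : n % 4 ≠ j := fun h => hcon ⟨n / 4, by simp only; omega⟩
    simp only [coef_eq_zero hv n this, zero_mul]

theorem z₁_eq (u : ℝ) : z₁ u = profile ![1, 0, 0, 0] u := by
  rw [← pow_mul_hyp13_eq_profile (a := -1 / 4) (b₁ := 1 / 4) (b₂ := 1 / 2) (b₃ := 3 / 4) (j := 0)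
    (by norm_num) (by norm_num) (by norm_num) (fun i hi => by fin_cases i <;> simp at hi ⊢) (by simp)
    (fun k => by rw [show (((0 : Fin 4) : ℕ) : ℝ) = 0 by simp]; ring)]
  simp [z₁]

theorem z₃_eq (u : ℝ) : z₃ u = profile ![0, 0, 2, 0] u := by
  rw [← pow_mul_hyp13_eq_profile (a := 1 / 4) (b₁ := 3 / 4) (b₂ := 5 / 4) (b₃ := 3 / 2) (j := 2)
    (by norm_num) (by norm_num) (by norm_num) (fun i hi => by fin_cases i <;> simp at hi ⊢) (by simp)
    (fun k => by rw [show (((2 : Fin 4) : ℕ) : ℝ) = 2 by simp]; ring)]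
  simp [z₃]

theorem z₄_eq (u : ℝ) : z₄ u = profile ![0, 0, 0, 6] u := by
  rw [← pow_mul_hyp13_eq_profile (a := 1 / 2) (b₁ := 5 / 4) (b₂ := 3 / 2) (b₃ := 7 / 4) (j := 3)
    (by norm_num) (by norm_num) (by norm_num) (fun i hi => by fin_cases i <;> simp at hi ⊢)
    (by simp [Nat.factorial]) (fun k => by rw [show (((3 : Fin 4) : ℕ) : ℝ) = 3 by simp]; ring)]
  simp [z₄]

/-- The recurrence factor `(n-1)/4` vanishes at `n = 1`, so this series stops at its linear term. -/
theorem z₂_eq (u : ℝ) : z₂ u = profile ![0, 1, 0, 0] u := by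
  have h : ∀ n : ℕ, n ≠ 1 → coef ![0, 1, 0, 0] n = 0 := by
    intro n
    induction n using Nat.strong_induction_on with
    | _ n ih =>
      intro hn
      match n, ih, hn with
      | 0, _, _ => simp [coef]
      | 2, _, _ => simp [coef]
      | 3, _, _ => simp [coef]
      | n + 4, ih, _ =>
        rw [coef_add_four]
        by_cases h1 : n = 1
        · simp [h1]
        · rw [ih n (by omega) h1, mul_zero]
  rw [profile_def, egf, tsum_eq_single 1]
  · simp [coef, z₂]
  · intro n hn
    rw [h n hn, zero_mul]

/-- The initial data of the profiles of `y₁, …, y₄`. -/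
noncomputable def initData (i : Fin 4) : Fin 4 → ℝ := fun j => D i j *
  ![1 / Real.Gamma (5 / 4), 1, 1 / Real.Gamma (3 / 4), 1 / Real.Gamma (1 / 2)] j

theorem mulVec_w (i : Fin 4) (u : ℝ) : D.mulVec (w u) i = profile (initData i) u := by
  have e : initData i = (D i 0 * (1 / Real.Gamma (5 / 4))) • ![1, 0, 0, 0] + D i 1 • ![0, 1, 0, 0] +
      (D i 2 * (1 / (2 * Real.Gamma (3 / 4)))) • ![0, 0, 2, 0] +
      (D i 3 * (1 / (6 * Real.Gamma (1 / 2)))) • ![0, 0, 0, 6] := by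
    funext j
    fin_cases j <;> simp [initData] <;> ring
  rw [e]
  simp only [map_add, map_smul, Pi.add_apply, Pi.smul_apply, smul_eq_mul, ← z₁_eq, ← z₂_eq, ← z₃_eq,
    ← z₄_eq, Matrix.mulVec, dotProduct, Fin.sum_univ_four, w]
  simp
  ring

theorem y_eq_profile (B : ℝ) (i : Fin 4) (t x : ℝ) :
    y B i t x = (B * t) ^ (1 / 4 : ℝ) * profile (initData i) (x / (B * t) ^ (1 / 4 : ℝ)) := by
  rw [y, mulVec_w]

/-! ### Reduction of the equation to the profile equation -/

theorem hasDerivAt_scale {B t : ℝ} (hB : 0 < B) (ht : 0 < t) :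
    HasDerivAt (fun s : ℝ => (B * s) ^ (1 / 4 : ℝ)) ((B * t) ^ (1 / 4 : ℝ) / (4 * t)) t := by
  have hBt : 0 < B * t := mul_pos hB ht
  have h := ((hasDerivAt_id t).const_mul B).rpow_const (p := 1 / 4) (Or.inl hBt.ne')
  refine h.congr_deriv ?_
  simp only [id, mul_one]
  rw [Real.rpow_sub hBt, Real.rpow_one]
  field_simp

theorem hasDerivAt_selfSimilar {B t x Z' : ℝ} {Z : ℝ → ℝ} (hB : 0 < B) (ht : 0 < t)
    (hZ : HasDerivAt Z Z' (x / (B * t) ^ (1 / 4 : ℝ))) :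
    HasDerivAt (fun s : ℝ => (B * s) ^ (1 / 4 : ℝ) * Z (x / (B * s) ^ (1 / 4 : ℝ)))
      ((B * t) ^ (1 / 4 : ℝ) / (4 * t) *
        (Z (x / (B * t) ^ (1 / 4 : ℝ)) - x / (B * t) ^ (1 / 4 : ℝ) * Z')) t := by
  have hq := hasDerivAt_scale hB ht
  have hq0 : 0 < (B * t) ^ (1 / 4 : ℝ) := Real.rpow_pos_of_pos (mul_pos hB ht) _
  have hu : HasDerivAt (fun s : ℝ => x / (B * s) ^ (1 / 4 : ℝ)) _ t :=
    (hasDerivAt_const t x).div hq hq0.ne'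
  have h : HasDerivAt (fun s : ℝ => (B * s) ^ (1 / 4 : ℝ) * Z (x / (B * s) ^ (1 / 4 : ℝ))) _ t :=
    hq.mul (hZ.comp t hu)
  refine h.congr_deriv ?_
  field_simp
  ring

theorem isSolution_profile {B : ℝ} (hB : 0 < B) (S : Set ℝ) (v : Fin 4 → ℝ) :
    IsSolution B S fun t x => (B * t) ^ (1 / 4 : ℝ) * profile v (x / (B * t) ^ (1 / 4 : ℝ)) := by
  constructor
  · intro t _
    have h := contDiff_profile 4 v
    push_cast at h
    exact (contDiff_const.mul (h.comp (contDiff_id.div_const _))).contDiffOn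
  · intro t ht x _
    have hBt : 0 < B * t := mul_pos hB ht
    set q := (B * t) ^ (1 / 4 : ℝ) with hq
    have hq0 : 0 < q := Real.rpow_pos_of_pos hBt _
    have hq4 : q ^ 4 = B * t := by
      rw [hq, ← Real.rpow_natCast, ← Real.rpow_mul hBt.le]
      norm_num
    have hd : HasDerivAt (profile v) (deriv (profile v) (x / q)) (x / q) :=
      ((contDiff_profile 1 v).differentiable (by simp) _).hasDerivAt
    have ht' := hasDerivAt_selfSimilar hB ht hd
    refine ⟨ht'.differentiableAt, ?_⟩
    rw [ht'.deriv, ← hq]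
    have e : (fun ξ => q * profile v (ξ / q)) = fun ξ => q * (fun ζ => profile v (q⁻¹ * ζ)) ξ := by
      funext ξ
      simp only [div_eq_inv_mul]
    rw [e, iteratedDeriv_const_mul_field, iteratedDeriv_comp_const_mul (contDiff_profile 4 v)]
    beta_reduce
    rw [← div_eq_inv_mul, iteratedDeriv_four_profile]
    have hB' : B = q ^ 4 / t := by rw [hq4]; field_simp
    rw [hB']
    field_simp
    ring

/-- A self-similar solution has a profile which solves `Z⁽⁴⁾ = (u Z⁽¹⁾ - Z) / 4`. -/
theorem profile_ode {B : ℝ} (hB : 0 < B) {S : Set ℝ} (hS : IsOpen S) {f : ℝ → ℝ → ℝ}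
    (hf : IsSolution B S f) {Z : ℝ → ℝ} (hZ : ∀ t, 0 < t → ∀ x ∈ S,
      f t x = (B * t) ^ (1 / 4 : ℝ) * Z (x / (B * t) ^ (1 / 4 : ℝ))) :
    ContDiffOn ℝ 4 Z S ∧ ∀ x ∈ S, iteratedDeriv 4 Z x = (x * deriv Z x - Z x) / 4 := by
  -- At time `1/B` the scale `q` equals `1`, so the solution coincides with `Z` there and the PDE at
  -- that single time is already the ODE.
  have hτ : 0 < B⁻¹ := inv_pos.2 hB
  have hq : (B * B⁻¹) ^ (1 / 4 : ℝ) = 1 := by rw [mul_inv_cancel₀ hB.ne', Real.one_rpow]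
  have hfZ : ∀ x ∈ S, f B⁻¹ x = Z x := fun x hx => by rw [hZ _ hτ x hx, hq, one_mul, div_one]
  have hC : ContDiffOn ℝ 4 Z S := (hf.1 _ hτ).congr fun x hx => (hfZ x hx).symm
  refine ⟨hC, fun x hx => ?_⟩
  have hxS : S ∈ 𝓝 x := hS.mem_nhds hx
  have hd : HasDerivAt Z (deriv Z x) x :=
    ((hC.contDiffAt hxS).differentiableAt (by norm_num)).hasDerivAt
  obtain ⟨-, heq⟩ := hf.2 _ hτ x hx
  have h1 : (fun s => f s x) =ᶠ[𝓝 B⁻¹]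
      fun s => (B * s) ^ (1 / 4 : ℝ) * Z (x / (B * s) ^ (1 / 4 : ℝ)) := by
    filter_upwards [lt_mem_nhds hτ] with s hs using hZ s hs x hx
  have h2 : (fun ξ => f B⁻¹ ξ) =ᶠ[𝓝 x] Z := by
    filter_upwards [hxS] with ξ hξ using hfZ ξ hξ
  have h3 := hasDerivAt_selfSimilar (x := x) (Z := Z) (Z' := deriv Z x) hB hτ
    (by rwa [hq, div_one])
  rw [h1.deriv_eq, h3.deriv, h2.iteratedDeriv_eq, hq, div_one] at heq
  have : B * (iteratedDeriv 4 Z x - (x * deriv Z x - Z x) / 4) = 0 := by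
    rw [← heq]
    field_simp
    ring
  rcases mul_eq_zero.1 this with h | h
  · exact absurd h hB.ne'
  · linarith

/-! ### Uniqueness and completeness for the profile equation -/

theorem hasDerivAt_iteratedDeriv {Z : ℝ → ℝ} {n : ℕ} {x : ℝ} (h : ContDiffAt ℝ n Z x) {k : ℕ}
    (hk : k < n) : HasDerivAt (iteratedDeriv k Z) (iteratedDeriv (k + 1) Z x) x := by
  rw [iteratedDeriv_succ]
  have h' := (contDiffWithinAt_univ.2 h).differentiableWithinAt_iteratedDerivWithin (m := k)
    (by exact_mod_cast hk) (by simp)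
  rw [iteratedDerivWithin_univ] at h'
  exact (differentiableWithinAt_univ.1 h').hasDerivAt

/-- The jet `(Z, Z', Z'', Z''')` solves a first-order linear system whose coefficients are bounded
on bounded intervals. It is therefore enough to enclose both points in a bounded open interval
inside `S` and apply uniqueness for Lipschitz systems. -/
theorem profile_ode_unique {S : Set ℝ} (hS : IsOpen S) (hS' : S.OrdConnected) {Z₁ Z₂ : ℝ → ℝ}
    (h₁ : ContDiffOn ℝ 4 Z₁ S) (h₂ : ContDiffOn ℝ 4 Z₂ S)
    (e₁ : ∀ x ∈ S, iteratedDeriv 4 Z₁ x = (x * deriv Z₁ x - Z₁ x) / 4)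
    (e₂ : ∀ x ∈ S, iteratedDeriv 4 Z₂ x = (x * deriv Z₂ x - Z₂ x) / 4)
    {x₀ : ℝ} (hx₀ : x₀ ∈ S) (h0 : ∀ k : Fin 4, iteratedDeriv k Z₁ x₀ = iteratedDeriv k Z₂ x₀) :
    EqOn Z₁ Z₂ S := by
  intro x hx
  obtain ⟨ε₁, hε₁, hb₁⟩ := Metric.isOpen_iff.1 hS x hx
  obtain ⟨ε₂, hε₂, hb₂⟩ := Metric.isOpen_iff.1 hS x₀ hx₀
  obtain ⟨a, b, hxab, hx₀ab, hab⟩ : ∃ a b, x ∈ Ioo a b ∧ x₀ ∈ Ioo a b ∧ Ioo a b ⊆ S := by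
    have m₁ : x - ε₁ / 2 ∈ S := hb₁ (by simp [abs_of_pos hε₁]; linarith)
    have m₂ : x + ε₁ / 2 ∈ S := hb₁ (by simp [abs_of_pos hε₁]; linarith)
    have m₃ : x₀ - ε₂ / 2 ∈ S := hb₂ (by simp [abs_of_pos hε₂]; linarith)
    have m₄ : x₀ + ε₂ / 2 ∈ S := hb₂ (by simp [abs_of_pos hε₂]; linarith)
    refine ⟨min (x - ε₁ / 2) (x₀ - ε₂ / 2), max (x + ε₁ / 2) (x₀ + ε₂ / 2),
      ⟨min_lt_of_left_lt (by linarith), lt_max_of_lt_left (by linarith)⟩,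
      ⟨min_lt_of_right_lt (by linarith), lt_max_of_lt_right (by linarith)⟩,
      Ioo_subset_Icc_self.trans (hS'.out ?_ ?_)⟩
    · rcases min_choice (x - ε₁ / 2) (x₀ - ε₂ / 2) with h | h <;> rw [h] <;> assumption
    · rcases max_choice (x + ε₁ / 2) (x₀ + ε₂ / 2) with h | h <;> rw [h] <;> assumption
  set V : ℝ → (Fin 4 → ℝ) → Fin 4 → ℝ := fun t p => ![p 1, p 2, p 3, (t * p 1 - p 0) / 4] with hV
  have hK : 0 ≤ max |a| |b| + 1 := by positivity
  have hLip : ∀ t ∈ Ioo a b, LipschitzOnWith ⟨max |a| |b| + 1, hK⟩ (V t) univ := by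
    intro t ht
    refine (LipschitzWith.of_dist_le_mul fun p q => ?_).lipschitzOnWith
    have htab : |t| ≤ max |a| |b| := abs_le_max_abs_abs ht.1.le ht.2.le
    have hd : 0 ≤ dist p q := dist_nonneg
    have h1 : dist p q ≤ (max |a| |b| + 1) * dist p q :=
      le_mul_of_one_le_left hd (by linarith [(abs_nonneg a).trans (le_max_left |a| |b|)])
    rw [dist_pi_le_iff (by positivity)]
    simp only [hV]
    change ∀ k, _ ≤ (max |a| |b| + 1) * dist p q
    intro k
    fin_cases k
    · exact (dist_le_pi_dist p q 1).trans h1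
    · exact (dist_le_pi_dist p q 2).trans h1
    · exact (dist_le_pi_dist p q 3).trans h1
    · have d1 := dist_le_pi_dist p q 1
      have d0 := dist_le_pi_dist p q 0
      simp only [Real.dist_eq] at d0 d1
      simp only [Fin.reduceFinMk, Matrix.cons_val, Real.dist_eq]
      have e : (t * p 1 - p 0) / 4 - (t * q 1 - q 0) / 4 =
          (t * (p 1 - q 1) - (p 0 - q 0)) / 4 := by ring
      rw [e, abs_div, abs_of_pos (by norm_num : (0 : ℝ) < 4)]
      have h2 : |t * (p 1 - q 1) - (p 0 - q 0)| ≤ (max |a| |b| + 1) * dist p q := by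
        refine (abs_sub _ _).trans ?_
        rw [abs_mul, add_mul, one_mul]
        gcongr
      have h3 := abs_nonneg (t * (p 1 - q 1) - (p 0 - q 0))
      linarith
  have hsol : ∀ Z : ℝ → ℝ, ContDiffOn ℝ 4 Z S →
      (∀ x ∈ S, iteratedDeriv 4 Z x = (x * deriv Z x - Z x) / 4) → ∀ t ∈ Ioo a b,
      HasDerivAt (fun s (k : Fin 4) => iteratedDeriv k Z s)
        (V t fun k : Fin 4 => iteratedDeriv k Z t) t ∧
      (fun k : Fin 4 => iteratedDeriv k Z t) ∈ (univ : Set (Fin 4 → ℝ)) := by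
    intro Z hZ he t ht
    refine ⟨hasDerivAt_pi.2 fun k => ?_, mem_univ _⟩
    have hc : ContDiffAt ℝ (4 : ℕ) Z t := by
      exact_mod_cast hZ.contDiffAt (hS.mem_nhds (hab ht))
    refine (hasDerivAt_iteratedDeriv hc k.2).congr_deriv ?_
    fin_cases k
    · simp [hV]
    · simp [hV]
    · simp [hV]
    · simp [hV, he t (hab ht), iteratedDeriv_one]
  have := ODE_solution_unique_of_mem_Ioo hLip hx₀ab (hsol Z₁ h₁ e₁) (hsol Z₂ h₂ e₂)
    (funext h0) hxab
  simpa using congrFun this 0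

/-- The derivatives of a profile are continuous on all of `ℝ`, so their vanishing on `S` passes to
the limit point `0`, where they are the initial data. -/
theorem eq_zero_of_profile_eqOn_zero {S : Set ℝ} (hS : IsOpen S) (h0 : (0 : ℝ) ∈ closure S)
    {v : Fin 4 → ℝ} (hv : EqOn (profile v) 0 S) : v = 0 := by
  funext k
  rw [← iteratedDeriv_profile_zero v k]
  have hc : Continuous (iteratedDeriv k (profile v)) :=
    (contDiff_profile k v).continuous_iteratedDeriv k le_rfl
  have hz : EqOn (iteratedDeriv k (profile v)) 0 S := by
    intro x hx
    have : profile v =ᶠ[𝓝 x] fun _ => (0 : ℝ) := by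
      filter_upwards [hS.mem_nhds hx] with y hy using hv hy
    rw [this.iteratedDeriv_eq]
    simp
  exact hz.closure hc continuous_const h0

/-- Every solution of `Z⁽⁴⁾ = (u Z⁽¹⁾ - Z) / 4` on an interval with `0` in its closure is the
restriction of an entire solution. -/
theorem exists_eqOn_profile {S : Set ℝ} (hS : IsOpen S) (hS' : S.OrdConnected)
    (h0 : (0 : ℝ) ∈ closure S) {Z : ℝ → ℝ} (hZ : ContDiffOn ℝ 4 Z S)
    (he : ∀ x ∈ S, iteratedDeriv 4 Z x = (x * deriv Z x - Z x) / 4) :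
    ∃ v, EqOn Z (profile v) S := by
  obtain ⟨x₀, hx₀⟩ : S.Nonempty := closure_nonempty_iff.1 ⟨0, h0⟩
  have hprof : ∀ v, ContDiffOn ℝ 4 (profile v) S := fun v => by
    exact_mod_cast (contDiff_profile 4 v).contDiffOn
  -- `J` carries data at `0` to the jet at `x₀`. ODE uniqueness makes it injective, hence surjective
  -- by dimension, so the jet of `Z` at `x₀` is attained by some profile.
  let J : (Fin 4 → ℝ) →ₗ[ℝ] Fin 4 → ℝ :=
    { toFun := fun v k => iteratedDeriv k (profile v) x₀
      map_add' := fun v w => by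
        funext k
        rw [map_add, iteratedDeriv_add (contDiff_profile k v).contDiffAt
          (contDiff_profile k w).contDiffAt]
        rfl
      map_smul' := fun c v => by
        funext k
        rw [map_smul, iteratedDeriv_const_smul_field]
        rfl }
  have hJ : Function.Injective J := by
    rw [← LinearMap.ker_eq_bot, LinearMap.ker_eq_bot']
    intro v hv
    refine eq_zero_of_profile_eqOn_zero hS h0 ?_
    rw [← LinearMap.map_zero profile]
    refine profile_ode_unique hS hS' (hprof _) (hprof _)
      (fun x _ => iteratedDeriv_four_profile _ x) (fun x _ => iteratedDeriv_four_profile _ x) hx₀ ?_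
    intro k
    exact (congrFun hv k).trans (congrFun J.map_zero k).symm
  obtain ⟨v, hv⟩ := (LinearMap.injective_iff_surjective.1 hJ) fun k => iteratedDeriv k Z x₀
  exact ⟨v, profile_ode_unique hS hS' hZ (hprof v) he
    (fun x _ => iteratedDeriv_four_profile _ x) hx₀ fun k => (congrFun hv k).symm⟩

/-! ### The fundamental set -/

theorem Gamma_ne_zero {x : ℝ} (hx : 0 < x) : Real.Gamma x ≠ 0 := (Real.Gamma_pos_of_pos hx).ne'

/-- The Gamma values only rescale the columns of `D` by nonzero factors, so the claim is the
independence of the rows of `D`. -/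
theorem linearIndependent_initData : LinearIndependent ℝ initData := by
  rw [Fintype.linearIndependent_iff]
  intro g hg
  have hs : (√2 : ℝ) ≠ 0 := by positivity
  have g1 := Gamma_ne_zero (x := 5 / 4) (by norm_num)
  have g2 := Gamma_ne_zero (x := 3 / 4) (by norm_num)
  have g3 := Gamma_ne_zero (x := 1 / 2) (by norm_num)
  have e : ∀ j, ∑ i, g i * D i j = 0 := by
    intro j
    have h := congrFun hg j
    simp only [Finset.sum_apply, Pi.smul_apply, smul_eq_mul, initData, Pi.zero_apply, ← mul_assoc,
      ← Finset.sum_mul] at h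
    refine (mul_eq_zero.1 h).resolve_right ?_
    fin_cases j
    · exact one_div_ne_zero g1
    · exact one_ne_zero
    · exact one_div_ne_zero g2
    · exact one_div_ne_zero g3
  have e0 := e 0
  have e1 := e 1
  have e2 := e 2
  have e3 := e 3
  simp [Fin.sum_univ_four, D] at e0 e1 e2 e3
  field_simp at e1 e3
  intro i
  fin_cases i <;> simp <;> linarith

theorem span_initData (v : Fin 4 → ℝ) : ∃ c : Fin 4 → ℝ, v = ∑ i, c i • initData i := by
  let b := basisOfLinearIndependentOfCardEqFinrank linearIndependent_initData (by simp)
  refine ⟨fun i => b.repr v i, ?_⟩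
  conv_lhs => rw [← b.sum_repr v]
  simp [b]

theorem sum_mul_y (B : ℝ) (c : Fin 4 → ℝ) (t x : ℝ) :
    ∑ i, c i * y B i t x = (B * t) ^ (1 / 4 : ℝ) *
      profile (∑ i, c i • initData i) (x / (B * t) ^ (1 / 4 : ℝ)) := by
  simp only [y_eq_profile, map_sum, map_smul, Finset.sum_apply, Pi.smul_apply, smul_eq_mul,
    Finset.mul_sum]
  exact Finset.sum_congr rfl fun i _ => by ring

theorem linIndepOn_y {B : ℝ} (hB : 0 < B) {S : Set ℝ} (hS : IsOpen S)
    (h0 : (0 : ℝ) ∈ closure S) : LinIndepOn S (y B) := by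
  rw [LinIndepOn, Fintype.linearIndependent_iff]
  intro g hg
  refine Fintype.linearIndependent_iff.1 linearIndependent_initData g ?_
  refine eq_zero_of_profile_eqOn_zero hS h0 fun x hx => ?_
  have h := congrFun hg ⟨(B⁻¹, x), inv_pos.2 hB, hx⟩
  simp only [Finset.sum_apply, Pi.smul_apply, smul_eq_mul, Set.domRestrict_apply, Pi.zero_apply] at h
  rw [sum_mul_y, mul_inv_cancel₀ hB.ne', Real.one_rpow, one_mul, div_one] at h
  exact h

theorem isSolution_y {B : ℝ} (hB : 0 < B) (S : Set ℝ) (i : Fin 4) : IsSolution B S (y B i) := by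
  have : y B i = fun t x => (B * t) ^ (1 / 4 : ℝ) *
      profile (initData i) (x / (B * t) ^ (1 / 4 : ℝ)) := by
    funext t x
    exact y_eq_profile B i t x
  rw [this]
  exact isSolution_profile hB S _

theorem isSelfSimilar_y (B : ℝ) (S : Set ℝ) (i : Fin 4) : IsSelfSimilar B S (y B i) :=
  ⟨profile (initData i), fun t _ x _ => y_eq_profile B i t x⟩

theorem isFundamentalSet_y {B : ℝ} (hB : 0 < B) {S : Set ℝ} (hS : IsOpen S)
    (hS' : S.OrdConnected) (h0 : (0 : ℝ) ∈ closure S)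
    (hscale : ∀ x ∈ S, ∀ q : ℝ, 0 < q → x / q ∈ S) : IsFundamentalSet B S (y B) := by
  refine ⟨fun i => ⟨isSolution_y hB S i, isSelfSimilar_y B S i⟩, linIndepOn_y hB hS h0, ?_⟩
  rintro f hf ⟨Z, hZ⟩
  obtain ⟨hC, he⟩ := profile_ode hB hS hf hZ
  obtain ⟨v, hv⟩ := exists_eqOn_profile hS hS' h0 hC he
  obtain ⟨c, hc⟩ := span_initData v
  refine ⟨c, fun t ht x hx => ?_⟩
  rw [sum_mul_y, ← hc, hZ t ht x hx,
    hv (hscale x hx _ (Real.rpow_pos_of_pos (mul_pos hB ht) _))]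

/-! ### Integral representation of profiles -/

open MeasureTheory

theorem integrableOn_div_sq {g : ℝ → ℝ} (hg : Continuous g) {C M : ℝ}
    (hC : ∀ s, 0 < s → s ≤ 1 → |g s| ≤ C * s ^ 2) (hM : ∀ s, 0 < s → |g s| ≤ M) :
    IntegrableOn (fun s => g s / s ^ 2) (Ioi 0) := by
  have hc : ContinuousOn (fun s => g s / s ^ 2) (Ioi 0) :=
    hg.continuousOn.div (continuous_pow 2).continuousOn fun s hs => (pow_pos hs 2).ne'
  rw [← Ioc_union_Ioi_eq_Ioi (zero_le_one' ℝ)]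
  refine IntegrableOn.union ?_ ?_
  · have h : IntegrableOn (fun _ : ℝ => C) (Ioc 0 1) := integrableOn_const (by simp)
    refine h.mono' ((hc.mono Ioc_subset_Ioi_self).aestronglyMeasurable measurableSet_Ioc) ?_
    refine (ae_restrict_iff' measurableSet_Ioc).2 (ae_of_all _ fun s hs => ?_)
    have hs0 : 0 < s := hs.1
    rw [Real.norm_eq_abs, abs_div, abs_of_pos (pow_pos hs0 2), div_le_iff₀ (pow_pos hs0 2)]
    exact hC s hs0 hs.2
  · have h := (integrableOn_Ioi_rpow_of_lt (a := -2) (by norm_num) one_pos).const_mul M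
    refine h.mono' ((hc.mono (Ioi_subset_Ioi zero_le_one)).aestronglyMeasurable measurableSet_Ioi) ?_
    refine (ae_restrict_iff' measurableSet_Ioi).2 (ae_of_all _ fun s hs => ?_)
    have hs0 : 0 < s := zero_lt_one.trans hs
    rw [Real.norm_eq_abs, abs_div, abs_of_pos (pow_pos hs0 2), Real.rpow_neg hs0.le, div_eq_mul_inv]
    norm_cast
    exact mul_le_mul_of_nonneg_right (hM s hs0) (by positivity)

theorem integrableOn_pow_mul_exp (n : ℕ) :
    IntegrableOn (fun s : ℝ => s ^ n * Real.exp (-s ^ 4)) (Ioi 0) := by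
  have h := integrableOn_rpow_mul_exp_neg_rpow (p := 4) (s := n)
    (by linarith [Nat.cast_nonneg (α := ℝ) n]) (by norm_num)
  refine h.congr_fun (fun s _ => ?_) measurableSet_Ioi
  simp only [Real.rpow_natCast]
  norm_cast

theorem integral_pow_mul_exp (n : ℕ) :
    ∫ s in Ioi (0 : ℝ), s ^ n * Real.exp (-s ^ 4) = 1 / 4 * Real.Gamma ((n + 1) / 4) := by
  rw [← integral_rpow_mul_exp_neg_rpow (p := 4) (q := n) (by norm_num)
    (by linarith [Nat.cast_nonneg (α := ℝ) n])]
  refine setIntegral_congr_fun measurableSet_Ioi fun s _ => ?_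
  simp only [Real.rpow_natCast]
  norm_cast

theorem one_sub_exp_nonneg (s : ℝ) : 0 ≤ 1 - Real.exp (-s ^ 4) := by
  have : Real.exp (-s ^ 4) ≤ 1 := Real.exp_le_one_iff.2 (by linarith [show 0 ≤ s ^ 4 by positivity])
  linarith

theorem one_sub_exp_le (s : ℝ) : 1 - Real.exp (-s ^ 4) ≤ s ^ 4 := by
  have := Real.add_one_le_exp (-s ^ 4)
  linarith

theorem integrableOn_kernel : IntegrableOn (fun s : ℝ => (1 - Real.exp (-s ^ 4)) / s ^ 2) (Ioi 0) := by
  refine integrableOn_div_sq (C := 1) (M := 1) (by fun_prop) ?_ ?_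
  · intro s hs hs1
    rw [abs_of_nonneg (one_sub_exp_nonneg s), one_mul]
    refine (one_sub_exp_le s).trans ?_
    exact pow_le_pow_of_le_one hs.le hs1 (by norm_num)
  · intro s _
    rw [abs_of_nonneg (one_sub_exp_nonneg s)]
    linarith [Real.exp_pos (-s ^ 4)]

theorem integral_kernel :
    ∫ s in Ioi (0 : ℝ), (1 - Real.exp (-s ^ 4)) / s ^ 2 = Real.Gamma (3 / 4) := by
  have hI := (integrableOn_pow_mul_exp 2).const_mul 4
  -- Integration by parts with `(1 - exp(-s⁴))/s`. Division by zero gives it the value `0` at `0`,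
  -- which is also its limit because it is at most `s³`.
  have key : ∫ s in Ioi (0 : ℝ), (4 * (s ^ 2 * Real.exp (-s ^ 4)) -
      (1 - Real.exp (-s ^ 4)) / s ^ 2) = 0 - (1 - Real.exp (-(0 : ℝ) ^ 4)) / 0 := by
    refine integral_Ioi_of_hasDerivAt_of_tendsto (f := fun s : ℝ => (1 - Real.exp (-s ^ 4)) / s)
      ?_ ?_ (hI.sub integrableOn_kernel) ?_
    · rw [ContinuousWithinAt, div_zero]
      have hb : Tendsto (fun s : ℝ => s ^ 3) (𝓝[≥] 0) (𝓝 0) := by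
        have : Tendsto (fun s : ℝ => s ^ 3) (𝓝 0) (𝓝 (0 ^ 3)) := (continuous_pow 3).tendsto 0
        rw [zero_pow three_ne_zero] at this
        exact this.mono_left nhdsWithin_le_nhds
      refine tendsto_of_tendsto_of_tendsto_of_le_of_le' tendsto_const_nhds hb ?_ ?_
      · filter_upwards [self_mem_nhdsWithin] with s hs using
          div_nonneg (one_sub_exp_nonneg s) hs
      · filter_upwards [self_mem_nhdsWithin] with s hs
        refine div_le_of_le_mul₀ hs (pow_nonneg hs 3) ((one_sub_exp_le s).trans (le_of_eq (by ring)))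
    · intro s hs
      have hs0 : s ≠ 0 := ne_of_gt hs
      have h0 : HasDerivAt (fun s : ℝ => -s ^ 4) _ s := (hasDerivAt_pow 4 s).neg
      have h1 : HasDerivAt (fun s : ℝ => 1 - Real.exp (-s ^ 4)) _ s := h0.exp.const_sub 1
      refine (h1.div (hasDerivAt_id s) hs0).congr_deriv ?_
      simp only [id]
      field_simp
      push_cast
      ring
    · have hb : Tendsto (fun s : ℝ => s⁻¹) atTop (𝓝 0) := tendsto_inv_atTop_zero
      refine tendsto_of_tendsto_of_tendsto_of_le_of_le' tendsto_const_nhds hb ?_ ?_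
      · filter_upwards [eventually_ge_atTop 0] with s hs using
          div_nonneg (one_sub_exp_nonneg s) hs
      · filter_upwards [eventually_ge_atTop 0] with s hs
        rw [div_eq_mul_inv]
        exact mul_le_of_le_one_left (inv_nonneg.2 hs) (by linarith [Real.exp_pos (-s ^ 4)])
  rw [integral_sub hI integrableOn_kernel, integral_const_mul, integral_pow_mul_exp] at key
  norm_num at key
  linarith

/-- The coefficients of a decaying solution, built from a sequence of period four. -/
noncomputable def gammaCoef (c : ℕ → ℝ) (n : ℕ) : ℝ := c n * Real.Gamma (((n : ℝ) - 1) / 4)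

/-- This is `Γ(x+1) = x Γ(x)` at `x = (n-1)/4`. The pole `x = 0` occurs at `n = 1`, which is why `c
1` has to vanish. -/
theorem gammaCoef_add_four {c : ℕ → ℝ} (hper : ∀ n, c (n + 4) = c n) (h1 : c 1 = 0) (n : ℕ) :
    gammaCoef c (n + 4) = ((n : ℝ) - 1) / 4 * gammaCoef c n := by
  by_cases hn : n = 1
  · subst hn
    simp [gammaCoef, hper, h1]
  · have hn' : ((n : ℝ) - 1) / 4 ≠ 0 := by
      refine div_ne_zero (sub_ne_zero.2 ?_) four_ne_zero
      exact_mod_cast hn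
    have e : (((n + 4 : ℕ) : ℝ) - 1) / 4 = ((n : ℝ) - 1) / 4 + 1 := by push_cast; ring
    rw [gammaCoef, gammaCoef, hper, e, Real.Gamma_add_one hn']
    ring

theorem Gamma_neg_quarter : Real.Gamma (-1 / 4) = -4 * Real.Gamma (3 / 4) := by
  have h := Real.Gamma_add_one (s := -1 / 4) (by norm_num)
  norm_num at h ⊢
  linarith

/-- Integrating term by term, the moments of `exp(-s⁴)` produce the coefficients with `n ≥ 2`. The
added `Γ(3/4)` cancels the term `n = 0` of the full series, as `Γ(-1/4) = -4 Γ(3/4)`. The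
interchange is legitimate because the integrals of the absolute values are the absolute values of
the terms of an entire series. -/
theorem integral_sub_one_mul_exp {c : ℕ → ℝ} {h : ℝ → ℝ} (hper : ∀ n, c (n + 4) = c n)
    (h0 : c 0 = 1) (h1 : c 1 = 0)
    (hh : ∀ s, HasSum (fun n : ℕ => c n * (s ^ n / (n.factorial : ℝ))) (h s)) (u : ℝ) :
    ∫ s in Ioi (0 : ℝ), (h (u * s) - 1) / s ^ 2 * Real.exp (-s ^ 4) =
      1 / 4 * egf (gammaCoef c) u + Real.Gamma (3 / 4) := by
  set F : ℕ → ℝ → ℝ := fun n s =>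
    c (n + 2) * (u ^ (n + 2) / ((n + 2).factorial : ℝ)) * (s ^ n * Real.exp (-s ^ 4)) with hF
  have hsum : IsEntire (gammaCoef c) := isEntire_of_recurrence (gammaCoef_add_four hper h1)
  have harg : ∀ n : ℕ, (((n + 2 : ℕ) : ℝ) - 1) / 4 = ((n : ℝ) + 1) / 4 := fun n => by
    push_cast
    ring
  have hFi : ∀ n, Integrable (F n) (volume.restrict (Ioi 0)) := fun n =>
    (integrableOn_pow_mul_exp n).const_mul _
  have hFint : ∀ n, ∫ s in Ioi (0 : ℝ), F n s =
      1 / 4 * (gammaCoef c (n + 2) * (u ^ (n + 2) / ((n + 2).factorial : ℝ))) := by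
    intro n
    rw [hF, integral_const_mul, integral_pow_mul_exp, gammaCoef, harg]
    ring
  have hFnorm : ∀ n, ∫ s in Ioi (0 : ℝ), ‖F n s‖ =
      |1 / 4 * (gammaCoef c (n + 2) * (u ^ (n + 2) / ((n + 2).factorial : ℝ)))| := by
    intro n
    have hΓ : 0 < Real.Gamma (((n : ℝ) + 1) / 4) := Real.Gamma_pos_of_pos (by positivity)
    have e : ∫ s in Ioi (0 : ℝ), ‖F n s‖ = ∫ s in Ioi (0 : ℝ),
        |c (n + 2) * (u ^ (n + 2) / ((n + 2).factorial : ℝ))| * (s ^ n * Real.exp (-s ^ 4)) := by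
      refine setIntegral_congr_fun measurableSet_Ioi fun s hs => ?_
      have hs' : 0 < s := hs
      simp only [hF, Real.norm_eq_abs]
      rw [abs_mul, abs_of_pos (a := s ^ n * Real.exp (-s ^ 4)) (by positivity)]
    rw [e, integral_const_mul, integral_pow_mul_exp, gammaCoef, harg]
    simp only [abs_mul, abs_of_pos hΓ, abs_of_pos (show (0 : ℝ) < 1 / 4 by norm_num)]
    ring
  have hs2 : Summable fun n : ℕ =>
      gammaCoef c (n + 2) * (u ^ (n + 2) / ((n + 2).factorial : ℝ)) :=
    (summable_nat_add_iff 2).2 (hsum u)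
  have hmain := hasSum_integral_of_summable_integral_norm hFi
    (by simp only [hFnorm]; exact (hs2.mul_left _).abs)
  have hpt : ∫ s in Ioi (0 : ℝ), ∑' n, F n s =
      ∫ s in Ioi (0 : ℝ), (h (u * s) - 1) / s ^ 2 * Real.exp (-s ^ 4) := by
    refine setIntegral_congr_fun measurableSet_Ioi fun s hs => ?_
    have hs' : s ≠ 0 := ne_of_gt hs
    have h2 := (hasSum_nat_add_iff' 2).2 (hh (u * s))
    simp only [Finset.sum_range_succ, Finset.sum_range_zero, h0, h1] at h2
    have h3 := (h2.div_const (s ^ 2)).mul_right (Real.exp (-s ^ 4))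
    simp only [pow_zero, Nat.factorial_zero, Nat.cast_one, div_one, mul_one, zero_mul, add_zero,
      zero_add] at h3
    rw [← h3.tsum_eq]
    refine tsum_congr fun n => ?_
    simp only [hF]
    rw [mul_pow, pow_add s n 2]
    field_simp
  rw [← hpt, ← hmain.tsum_eq]
  simp only [hFint]
  have hE : egf (gammaCoef c) u = Real.Gamma (-1 / 4) +
      ∑' n : ℕ, gammaCoef c (n + 2) * (u ^ (n + 2) / ((n + 2).factorial : ℝ)) := by
    rw [egf, ← (hsum u).sum_add_tsum_nat_add 2]
    congr 1
    simp [Finset.sum_range_succ, gammaCoef, h0, h1, neg_div]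
  rw [tsum_mul_left, hE, Gamma_neg_quarter]
  ring

theorem integrableOn_comp_mul_div_sq {g : ℝ → ℝ} (hg : IntegrableOn (fun s => g s / s ^ 2) (Ioi 0))
    {u : ℝ} (hu : 0 < u) : IntegrableOn (fun s => g (u * s) / s ^ 2) (Ioi 0) := by
  have h := (integrableOn_Ioi_comp_mul_left_iff (fun s => g s / s ^ 2) 0 hu).2 (by rwa [mul_zero])
  have h2 : IntegrableOn (fun s => u ^ 2 * (g (u * s) / (u * s) ^ 2)) (Ioi 0) := h.const_mul (u ^ 2)
  refine h2.congr_fun (fun s hs => ?_) measurableSet_Ioi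
  have hs' : s ≠ 0 := ne_of_gt hs
  simp only
  field_simp

theorem integral_comp_mul_div_sq (g : ℝ → ℝ) {u : ℝ} (hu : 0 < u) :
    ∫ s in Ioi (0 : ℝ), g (u * s) / s ^ 2 = u * ∫ s in Ioi (0 : ℝ), g s / s ^ 2 := by
  have h := integral_comp_mul_left_Ioi (fun s => g s / s ^ 2) 0 hu
  rw [mul_zero, smul_eq_mul] at h
  have e : ∫ s in Ioi (0 : ℝ), g (u * s) / s ^ 2 =
      ∫ s in Ioi (0 : ℝ), u ^ 2 * (g (u * s) / (u * s) ^ 2) := by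
    refine setIntegral_congr_fun measurableSet_Ioi fun s hs => ?_
    have hs' : s ≠ 0 := ne_of_gt hs
    field_simp
  rw [e, integral_const_mul, h]
  field_simp

/-- Subtracting `1` from `h` makes the two parts of the kernel separately integrable: one scales
linearly in `u`, the other is the series. The integral of the kernel itself cancels the leftover
`Γ(3/4)`. -/
theorem integral_comp_mul_kernel {c : ℕ → ℝ} {h : ℝ → ℝ} (hper : ∀ n, c (n + 4) = c n)
    (h0 : c 0 = 1) (h1 : c 1 = 0)
    (hh : ∀ s, HasSum (fun n : ℕ => c n * (s ^ n / (n.factorial : ℝ))) (h s))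
    (hint : IntegrableOn (fun s => (h s - 1) / s ^ 2) (Ioi 0)) {u : ℝ} (hu : 0 < u) :
    ∫ s in Ioi (0 : ℝ), h (u * s) * ((1 - Real.exp (-s ^ 4)) / s ^ 2) =
      u * (∫ s in Ioi (0 : ℝ), (h s - 1) / s ^ 2) - 1 / 4 * egf (gammaCoef c) u := by
  have hi := integrableOn_comp_mul_div_sq (g := fun s => h s - 1) hint hu
  have hi2 : IntegrableOn (fun s => (h (u * s) - 1) / s ^ 2 * Real.exp (-s ^ 4)) (Ioi 0) := by
    refine hi.mul_bdd (c := 1)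
      (by fun_prop : Continuous fun s : ℝ => Real.exp (-s ^ 4)).aestronglyMeasurable ?_
    refine ae_of_all _ fun s => ?_
    rw [Real.norm_eq_abs, abs_of_pos (Real.exp_pos _)]
    linarith [one_sub_exp_nonneg s]
  have e : ∫ s in Ioi (0 : ℝ), h (u * s) * ((1 - Real.exp (-s ^ 4)) / s ^ 2) =
      ∫ s in Ioi (0 : ℝ), ((h (u * s) - 1) / s ^ 2 - (h (u * s) - 1) / s ^ 2 * Real.exp (-s ^ 4) +
        (1 - Real.exp (-s ^ 4)) / s ^ 2) := by
    congr 1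
    funext s
    ring
  have hi3 : IntegrableOn (fun s => (h (u * s) - 1) / s ^ 2 -
      (h (u * s) - 1) / s ^ 2 * Real.exp (-s ^ 4)) (Ioi 0) := hi.sub hi2
  rw [e, integral_add hi3 integrableOn_kernel, integral_sub hi hi2, integral_kernel,
    integral_comp_mul_div_sq (fun s => h s - 1) hu, integral_sub_one_mul_exp hper h0 h1 hh]
  ring

/-! ### Evaluation of the constant integrals by Laplace transforms -/

theorem integral_mul_exp_neg_mul {s : ℝ} (hs : 0 < s) :
    ∫ r in Ioi (0 : ℝ), r * Real.exp (-(s * r)) = 1 / s ^ 2 := by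
  have h := Real.integral_rpow_mul_exp_neg_mul_Ioi (a := 2) two_pos hs
  have e : ∀ r : ℝ, r ^ ((2 : ℝ) - 1) = r := fun r => by norm_num
  simp only [e, Real.Gamma_two, mul_one, Real.rpow_two, div_pow, one_pow] at h
  exact h

theorem integrableOn_mul_exp_neg_mul {s : ℝ} (hs : 0 < s) :
    IntegrableOn (fun r : ℝ => r * Real.exp (-(s * r))) (Ioi 0) :=
  Integrable.of_integral_ne_zero (by rw [integral_mul_exp_neg_mul hs]; positivity)

/-- `∫ g(s) / s² ds` in terms of the Laplace transform of `g`. -/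
theorem integral_div_sq_eq_laplace {g : ℝ → ℝ} (hg : Continuous g)
    (hint : IntegrableOn (fun s => g s / s ^ 2) (Ioi 0)) :
    IntegrableOn (fun r => r * ∫ s in Ioi (0 : ℝ), g s * Real.exp (-(r * s))) (Ioi 0) ∧
      ∫ s in Ioi (0 : ℝ), g s / s ^ 2 =
        ∫ r in Ioi (0 : ℝ), r * ∫ s in Ioi (0 : ℝ), g s * Real.exp (-(r * s)) := by
  -- Fubini applied to `1/s² = ∫ r exp(-sr) dr`; absolute integrability of `f` is that of `g(s)/s²`.
  set f : ℝ → ℝ → ℝ := fun s r => g s * (r * Real.exp (-(s * r))) with hf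
  have hfc : Continuous (Function.uncurry f) := by
    simp only [hf, Function.uncurry_def]
    fun_prop
  have hI : Integrable (Function.uncurry f)
      ((volume.restrict (Ioi 0)).prod (volume.restrict (Ioi 0))) := by
    rw [integrable_prod_iff hfc.aestronglyMeasurable]
    refine ⟨(ae_restrict_iff' measurableSet_Ioi).2 (ae_of_all _ fun s hs =>
      (integrableOn_mul_exp_neg_mul hs).const_mul (g s)), ?_⟩
    have hn : IntegrableOn (fun s => |g s / s ^ 2|) (Ioi 0) := hint.abs
    refine hn.congr_fun (fun s hs => ?_) measurableSet_Ioi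
    have hs' : 0 < s := hs
    have e : ∫ r in Ioi (0 : ℝ), ‖Function.uncurry f (s, r)‖ =
        ∫ r in Ioi (0 : ℝ), |g s| * (r * Real.exp (-(s * r))) := by
      refine setIntegral_congr_fun measurableSet_Ioi fun r hr => ?_
      have hr' : 0 < r := hr
      simp only [Function.uncurry, hf, Real.norm_eq_abs]
      rw [abs_mul, abs_of_pos (a := r * _) (by positivity)]
    simp only
    rw [e, integral_const_mul, integral_mul_exp_neg_mul hs', abs_div, abs_of_pos (pow_pos hs' 2)]
    ring
  have hin : ∀ r, ∫ s in Ioi (0 : ℝ), f s r =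
      r * ∫ s in Ioi (0 : ℝ), g s * Real.exp (-(r * s)) := by
    intro r
    rw [← integral_const_mul]
    congr 1
    funext s
    simp only [hf, mul_comm s r]
    ring
  constructor
  · have := hI.integral_prod_right
    simp only [Function.uncurry, hin] at this
    exact this
  · have h1 : ∫ s in Ioi (0 : ℝ), g s / s ^ 2 =
        ∫ s in Ioi (0 : ℝ), ∫ r in Ioi (0 : ℝ), f s r := by
      refine setIntegral_congr_fun measurableSet_Ioi fun s hs => ?_
      simp only [hf]
      rw [integral_const_mul, integral_mul_exp_neg_mul hs]
      ring
    rw [h1, integral_integral_swap hI]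
    simp only [hin]

theorem laplace_exp_I {r : ℝ} (hr : 0 < r) :
    IntegrableOn (fun s : ℝ => Complex.exp ((-r + Complex.I) * s)) (Ioi 0) ∧
      ∫ s in Ioi (0 : ℝ), Complex.exp ((-r + Complex.I) * s) =
        ((r / (r ^ 2 + 1) : ℝ) : ℂ) + ((1 / (r ^ 2 + 1) : ℝ) : ℂ) * Complex.I := by
  have hre : ((-r + Complex.I : ℂ)).re < 0 := by simpa using hr
  refine ⟨integrableOn_exp_mul_complex_Ioi hre 0, ?_⟩
  rw [integral_exp_mul_complex_Ioi hre 0]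
  have hne : (-r + Complex.I : ℂ) ≠ 0 := fun h => by
    rw [h] at hre
    simp at hre
  have h2 : ((r : ℂ) ^ 2 + 1) ≠ 0 := by
    have : (0 : ℝ) < r ^ 2 + 1 := by positivity
    exact_mod_cast this.ne'
  push_cast
  rw [mul_zero, Complex.exp_zero, div_eq_iff hne]
  field_simp
  ring_nf
  rw [Complex.I_sq]
  ring

theorem exp_I_mul_re (r s : ℝ) :
    (Complex.exp ((-r + Complex.I) * s)).re = Real.cos s * Real.exp (-(r * s)) := by
  rw [Complex.exp_re]
  simp
  ring

theorem exp_I_mul_im (r s : ℝ) :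
    (Complex.exp ((-r + Complex.I) * s)).im = Real.sin s * Real.exp (-(r * s)) := by
  rw [Complex.exp_im]
  simp
  ring

theorem laplace_cos {r : ℝ} (hr : 0 < r) :
    IntegrableOn (fun s : ℝ => Real.cos s * Real.exp (-(r * s))) (Ioi 0) ∧
      ∫ s in Ioi (0 : ℝ), Real.cos s * Real.exp (-(r * s)) = r / (r ^ 2 + 1) := by
  obtain ⟨hI, hv⟩ := laplace_exp_I hr
  have h1 := integral_re hI
  have h2 := hI.re
  simp only [RCLike.re_to_complex, exp_I_mul_re] at h1 h2
  refine ⟨h2, ?_⟩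
  rw [h1, hv]
  simp only [Complex.add_re, Complex.ofReal_re, Complex.re_ofReal_mul, Complex.I_re]
  ring

theorem laplace_sin {r : ℝ} (hr : 0 < r) :
    IntegrableOn (fun s : ℝ => Real.sin s * Real.exp (-(r * s))) (Ioi 0) ∧
      ∫ s in Ioi (0 : ℝ), Real.sin s * Real.exp (-(r * s)) = 1 / (r ^ 2 + 1) := by
  obtain ⟨hI, hv⟩ := laplace_exp_I hr
  have h1 := integral_im hI
  have h2 := hI.im
  simp only [RCLike.im_to_complex, exp_I_mul_im] at h1 h2
  refine ⟨h2, ?_⟩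
  rw [h1, hv]
  simp only [Complex.add_im, Complex.ofReal_im, Complex.im_ofReal_mul, Complex.I_im]
  ring

theorem laplace_one {r : ℝ} (hr : 0 < r) :
    IntegrableOn (fun s : ℝ => Real.exp (-(r * s))) (Ioi 0) ∧
      ∫ s in Ioi (0 : ℝ), Real.exp (-(r * s)) = 1 / r := by
  have h1 := integrableOn_exp_mul_Ioi (a := -r) (by linarith) 0
  have h2 := integral_exp_mul_Ioi (a := -r) (by linarith) 0
  simp only [neg_mul] at h1 h2
  refine ⟨h1, ?_⟩
  rw [h2]
  simp

theorem integrableOn_cos_sub_one : IntegrableOn (fun s : ℝ => (Real.cos s - 1) / s ^ 2) (Ioi 0) := by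
  refine integrableOn_div_sq (C := 1) (M := 2) (by fun_prop) ?_ ?_
  · intro s _ _
    rw [abs_le]
    have := Real.one_sub_sq_div_two_le_cos (x := s)
    have := Real.cos_le_one s
    constructor <;> nlinarith [sq_nonneg s]
  · intro s _
    rw [abs_le]
    constructor <;> linarith [Real.neg_one_le_cos s, Real.cos_le_one s]

theorem integral_cos_sub_one : ∫ s in Ioi (0 : ℝ), (Real.cos s - 1) / s ^ 2 = -(Real.pi / 2) := by
  rw [(integral_div_sq_eq_laplace (g := fun s => Real.cos s - 1) (by fun_prop)
    integrableOn_cos_sub_one).2]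
  have h := integral_Ioi_inv_one_add_sq (i := 0)
  rw [Real.arctan_zero, sub_zero] at h
  rw [← h, ← integral_neg]
  refine setIntegral_congr_fun measurableSet_Ioi fun r hr => ?_
  have hr' : 0 < r := hr
  simp only [sub_mul, one_mul]
  rw [integral_sub (laplace_cos hr').1 (laplace_one hr').1, (laplace_cos hr').2, (laplace_one hr').2]
  field_simp
  ring

theorem integrableOn_exp_add_sin_sub_one :
    IntegrableOn (fun s : ℝ => (Real.exp (-s) + Real.sin s - 1) / s ^ 2) (Ioi 0) := by
  refine integrableOn_div_sq (C := 2) (M := 3) (by fun_prop) ?_ ?_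
  · intro s hs hs1
    have h1 := abs_le.1 (Real.abs_exp_sub_one_sub_id_le (x := -s) (by rw [abs_neg, abs_of_pos hs]; exact hs1))
    have h2 := Real.sin_gt_sub_cube hs
    have h3 := Real.sin_lt hs
    have h4 : s ^ 3 ≤ s ^ 2 := pow_le_pow_of_le_one hs.le hs1 (by norm_num)
    have h5 : 0 < s ^ 2 := by positivity
    rw [abs_le]
    rw [neg_sq] at h1
    constructor <;> linarith [h1.1, h1.2]
  · intro s hs
    have h1 : Real.exp (-s) ≤ 1 := Real.exp_le_one_iff.2 (by linarith)
    have h2 := Real.exp_pos (-s)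
    rw [abs_le]
    constructor <;> linarith [Real.neg_one_le_sin s, Real.sin_le_one s]

/-- The exponential and the sine must be kept together: their linear terms at `0` cancel, whereas
each alone leaves a nonintegrable `1/s`. On the Laplace side the integrand has the antiderivative
`log(r²+1)/2 - log(r+1)`, which is `0` at both ends. -/
theorem integral_exp_add_sin_sub_one :
    ∫ s in Ioi (0 : ℝ), (Real.exp (-s) + Real.sin s - 1) / s ^ 2 = 0 := by
  obtain ⟨hI, hv⟩ := integral_div_sq_eq_laplace (g := fun s => Real.exp (-s) + Real.sin s - 1)
    (by fun_prop) integrableOn_exp_add_sin_sub_one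
  have hin : ∀ r ∈ Ioi (0 : ℝ), r * ∫ s in Ioi (0 : ℝ),
      (Real.exp (-s) + Real.sin s - 1) * Real.exp (-(r * s)) = r / (r ^ 2 + 1) - 1 / (r + 1) := by
    intro r hr
    have hr' : 0 < r := hr
    have e : ∀ s : ℝ, (Real.exp (-s) + Real.sin s - 1) * Real.exp (-(r * s)) =
        Real.exp (-((r + 1) * s)) + Real.sin s * Real.exp (-(r * s)) - Real.exp (-(r * s)) := by
      intro s
      rw [sub_mul, add_mul, ← Real.exp_add, one_mul]
      congr 4
      ring
    have l1 := laplace_one (r := r + 1) (by linarith)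
    have l2 := laplace_sin hr'
    have l3 := laplace_one hr'
    have l4 : IntegrableOn (fun s => Real.exp (-((r + 1) * s)) + Real.sin s * Real.exp (-(r * s)))
      (Ioi 0) := l1.1.add l2.1
    simp only [e]
    rw [integral_sub l4 l3.1, integral_add l1.1 l2.1, l1.2, l2.2, l3.2]
    field_simp
    ring
  rw [hv, setIntegral_congr_fun measurableSet_Ioi hin]
  have hI' : IntegrableOn (fun r : ℝ => r / (r ^ 2 + 1) - 1 / (r + 1)) (Ioi 0) :=
    hI.congr_fun hin measurableSet_Ioi
  have hF : ∀ r ∈ Ici (0 : ℝ), HasDerivAt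
      (fun r => Real.log (r ^ 2 + 1) / 2 - Real.log (r + 1)) (r / (r ^ 2 + 1) - 1 / (r + 1)) r := by
    intro r hr
    have hr' : (0 : ℝ) ≤ r := hr
    have d1 : HasDerivAt (fun r : ℝ => r ^ 2 + 1) _ r := (hasDerivAt_pow 2 r).add_const 1
    have d2 : HasDerivAt (fun r : ℝ => r + 1) _ r := (hasDerivAt_id r).add_const 1
    refine (((d1.log (by positivity)).div_const 2).sub (d2.log (by positivity))).congr_deriv ?_
    push_cast
    ring
  have hlim : Tendsto (fun r : ℝ => Real.log (r ^ 2 + 1) / 2 - Real.log (r + 1)) atTop (𝓝 0) := by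
    -- This is `2r/(r²+1) = (r+1)²/(r²+1) - 1`, written in `1/r` so that the limit is immediate.
    have h1 : Tendsto (fun r : ℝ => 2 * (r⁻¹ * (1 + r⁻¹ ^ 2)⁻¹)) atTop (𝓝 (2 * (0 * (1 + 0 ^ 2)⁻¹))) := by
      have := tendsto_inv_atTop_zero (𝕜 := ℝ)
      exact (this.mul (((this.pow 2).const_add 1).inv₀ (by norm_num))).const_mul 2
    have h2 : Tendsto (fun r : ℝ => -(Real.log (1 + 2 * (r⁻¹ * (1 + r⁻¹ ^ 2)⁻¹)) / 2)) atTop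
        (𝓝 (-(Real.log (1 + 2 * (0 * (1 + 0 ^ 2)⁻¹)) / 2))) :=
      (((h1.const_add 1).log (by norm_num)).div_const 2).neg
    rw [show -(Real.log (1 + 2 * (0 * (1 + 0 ^ 2)⁻¹)) / 2) = (0 : ℝ) by norm_num] at h2
    refine h2.congr' ?_
    filter_upwards [eventually_gt_atTop 0] with r hr
    have e : 1 + 2 * (r⁻¹ * (1 + r⁻¹ ^ 2)⁻¹) = (r + 1) ^ 2 / (r ^ 2 + 1) := by
      field_simp
      ring
    rw [e, Real.log_div (by positivity) (by positivity), Real.log_pow]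
    push_cast
    ring
  rw [integral_Ioi_of_hasDerivAt_of_tendsto' hF hI' hlim]
  simp

/-! ### Vanishing of the kernel transforms at infinity -/

theorem tendsto_integral_exp_I_mul (k : ℝ → ℝ) :
    Tendsto (fun u : ℝ => ∫ s in Ioi (0 : ℝ), Complex.exp ((u * s : ℝ) * Complex.I) * (k s : ℂ)) atTop
      (𝓝 0) := by
  have h := Real.tendsto_integral_exp_smul_cocompact (E := ℂ) ((Ioi (0 : ℝ)).indicator fun s => (k s : ℂ))
  -- The frequency `-u/(2π)` turns the normalized Fourier character into `exp(ius)`.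
  have hu : Tendsto (fun u : ℝ => -u / (2 * Real.pi)) atTop (cocompact ℝ) := by
    refine Tendsto.mono_right ?_ atBot_le_cocompact
    exact tendsto_neg_atTop_atBot.atBot_div_const (by positivity)
  refine (h.comp hu).congr fun u => ?_
  simp only [Function.comp_apply]
  rw [← integral_indicator measurableSet_Ioi]
  congr 1
  funext s
  by_cases hs : s ∈ Ioi (0 : ℝ)
  · simp only [indicator_of_mem hs, Circle.smul_def, Real.fourierChar_apply, smul_eq_mul]
    congr 4
    field_simp
  · simp only [indicator_of_notMem hs, smul_zero]

theorem integrableOn_exp_I_mul {k : ℝ → ℝ} (hk : IntegrableOn k (Ioi 0)) (u : ℝ) :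
    IntegrableOn (fun s : ℝ => Complex.exp ((u * s : ℝ) * Complex.I) * (k s : ℂ)) (Ioi 0) := by
  refine Integrable.bdd_mul (c := 1) hk.ofReal (by fun_prop : Continuous fun s : ℝ =>
    Complex.exp ((u * s : ℝ) * Complex.I)).aestronglyMeasurable (ae_of_all _ fun s => ?_)
  rw [Complex.norm_exp_ofReal_mul_I]

theorem tendsto_integral_cos_mul {k : ℝ → ℝ} (hk : IntegrableOn k (Ioi 0)) :
    Tendsto (fun u : ℝ => ∫ s in Ioi (0 : ℝ), Real.cos (u * s) * k s) atTop (𝓝 0) := by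
  have h := (Complex.continuous_re.tendsto 0).comp (tendsto_integral_exp_I_mul k)
  refine h.congr fun u => ?_
  have e := integral_re (integrableOn_exp_I_mul hk u)
  simp only [RCLike.re_to_complex, Complex.re_mul_ofReal, Complex.exp_ofReal_mul_I_re] at e
  exact e.symm

theorem tendsto_integral_sin_mul {k : ℝ → ℝ} (hk : IntegrableOn k (Ioi 0)) :
    Tendsto (fun u : ℝ => ∫ s in Ioi (0 : ℝ), Real.sin (u * s) * k s) atTop (𝓝 0) := by
  have h := (Complex.continuous_im.tendsto 0).comp (tendsto_integral_exp_I_mul k)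
  refine h.congr fun u => ?_
  have e := integral_im (integrableOn_exp_I_mul hk u)
  simp only [RCLike.im_to_complex, Complex.im_mul_ofReal, Complex.exp_ofReal_mul_I_im] at e
  exact e.symm

theorem tendsto_integral_exp_neg_mul {k : ℝ → ℝ} (hk : IntegrableOn k (Ioi 0)) :
    Tendsto (fun u : ℝ => ∫ s in Ioi (0 : ℝ), Real.exp (-(u * s)) * k s) atTop (𝓝 0) := by
  have h := tendsto_integral_filter_of_dominated_convergence (μ := volume.restrict (Ioi (0 : ℝ)))
    (l := atTop) (F := fun (u : ℝ) s => Real.exp (-(u * s)) * k s) (f := fun _ => 0) (fun s => |k s|)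
    (Eventually.of_forall fun u => (by fun_prop : Continuous fun s : ℝ =>
      Real.exp (-(u * s))).aestronglyMeasurable.mul hk.aestronglyMeasurable) ?_ hk.abs ?_
  · simpa using h
  · filter_upwards [eventually_ge_atTop 0] with u hu
    refine (ae_restrict_iff' measurableSet_Ioi).2 (ae_of_all _ fun s hs => ?_)
    have hs' : 0 < s := hs
    rw [Real.norm_eq_abs, abs_mul, abs_of_pos (Real.exp_pos _)]
    exact mul_le_of_le_one_left (abs_nonneg _) (Real.exp_le_one_iff.2 (by nlinarith))
  · refine (ae_restrict_iff' measurableSet_Ioi).2 (ae_of_all _ fun s hs => ?_)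
    have h1 : Tendsto (fun u : ℝ => Real.exp (-(u * s))) atTop (𝓝 0) :=
      Real.tendsto_exp_neg_atTop_nhds_zero.comp (tendsto_id.atTop_mul_const hs)
    simpa using h1.mul_const (k s)

/-! ### Decaying profiles at `+∞` -/

theorem hasSum_cexp_I (s : ℝ) :
    HasSum (fun n : ℕ => Complex.I ^ n * ((s ^ n / (n.factorial : ℝ) : ℝ) : ℂ))
      (Complex.exp (s * Complex.I)) := by
  have h := NormedSpace.expSeries_div_hasSum_exp ((s : ℂ) * Complex.I)
  rw [← Complex.exp_eq_exp_ℂ] at h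
  have e : (fun n : ℕ => Complex.I ^ n * ((s ^ n / (n.factorial : ℝ) : ℝ) : ℂ)) =
      fun n : ℕ => ((s : ℂ) * Complex.I) ^ n / (n.factorial : ℂ) := by
    funext n
    push_cast
    rw [mul_pow]
    ring
  rw [e]
  exact h

theorem hasSum_cos (s : ℝ) :
    HasSum (fun n : ℕ => (Complex.I ^ n).re * (s ^ n / (n.factorial : ℝ))) (Real.cos s) := by
  have h := Complex.hasSum_re (hasSum_cexp_I s)
  simpa only [Complex.re_mul_ofReal, Complex.exp_ofReal_mul_I_re] using h

theorem hasSum_sin (s : ℝ) :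
    HasSum (fun n : ℕ => (Complex.I ^ n).im * (s ^ n / (n.factorial : ℝ))) (Real.sin s) := by
  have h := Complex.hasSum_im (hasSum_cexp_I s)
  simpa only [Complex.im_mul_ofReal, Complex.exp_ofReal_mul_I_im] using h

theorem hasSum_exp_neg (s : ℝ) :
    HasSum (fun n : ℕ => (-1) ^ n * (s ^ n / (n.factorial : ℝ))) (Real.exp (-s)) := by
  have h := NormedSpace.expSeries_div_hasSum_exp (-s)
  rw [← Real.exp_eq_exp_ℝ] at h
  have e : (fun n : ℕ => (-1) ^ n * (s ^ n / (n.factorial : ℝ))) =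
      fun n : ℕ => (-s) ^ n / (n.factorial : ℝ) := by
    funext n
    rw [neg_pow s]
    ring
  rw [e]
  exact h

theorem I_pow_add_four (n : ℕ) : Complex.I ^ (n + 4) = Complex.I ^ n := by
  rw [pow_add, Complex.I_pow_four, mul_one]

theorem egf_gammaCoef {c : ℕ → ℝ} (hper : ∀ n, c (n + 4) = c n) (h1 : c 1 = 0) :
    egf (gammaCoef c) = profile ![c 0 * Real.Gamma (-1 / 4), 0, c 2 * Real.Gamma (1 / 4),
      c 3 * Real.Gamma (1 / 2)] := by
  have h : gammaCoef c = coef ![c 0 * Real.Gamma (-1 / 4), 0, c 2 * Real.Gamma (1 / 4),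
      c 3 * Real.Gamma (1 / 2)] := by
    funext n
    rw [eq_coef (gammaCoef_add_four hper h1) n]
    congr 1
    simp only [gammaCoef, h1]
    norm_num
  rw [profile_def, h]

theorem tendsto_profile_cos :
    Tendsto (fun u => 2 * Real.pi * u + profile ![Real.Gamma (-1 / 4), 0, -Real.Gamma (1 / 4), 0] u) atTop
      (𝓝 0) := by
  have hper : ∀ n, (Complex.I ^ (n + 4)).re = (Complex.I ^ n).re := fun n => by rw [I_pow_add_four]
  -- The factor `-4` clears the `-1/4` in front of the series and turns `-(π/2) u` into `2πu`.
  have h := (tendsto_integral_cos_mul integrableOn_kernel).const_mul (-4)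
  rw [mul_zero] at h
  refine h.congr' ?_
  filter_upwards [eventually_gt_atTop 0] with u hu
  rw [integral_comp_mul_kernel (c := fun n => (Complex.I ^ n).re) hper (by simp) (by simp) hasSum_cos
    integrableOn_cos_sub_one hu, integral_cos_sub_one, egf_gammaCoef hper (by simp)]
  simp [pow_succ]
  ring

theorem tendsto_profile_exp_add_sin :
    Tendsto (profile ![Real.Gamma (-1 / 4), 0, Real.Gamma (1 / 4), -2 * Real.Gamma (1 / 2)]) atTop
      (𝓝 0) := by
  set c : ℕ → ℝ := fun n => (-1) ^ n + (Complex.I ^ n).im with hc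
  have hper : ∀ n, c (n + 4) = c n := fun n => by
    simp only [hc]
    rw [I_pow_add_four, pow_add]
    norm_num
  have hsum : ∀ s, HasSum (fun n : ℕ => c n * (s ^ n / (n.factorial : ℝ)))
      (Real.exp (-s) + Real.sin s) := fun s => by
    simp only [hc, add_mul]
    exact (hasSum_exp_neg s).add (hasSum_sin s)
  have hk := integrableOn_kernel
  have h := ((tendsto_integral_exp_neg_mul hk).add (tendsto_integral_sin_mul hk)).const_mul (-4)
  rw [add_zero, mul_zero] at h
  refine h.congr' ?_
  filter_upwards [eventually_gt_atTop 0] with u hu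
  have hm := integral_comp_mul_kernel (h := fun s => Real.exp (-s) + Real.sin s) hper (by simp [hc])
    (by simp [hc]) hsum integrableOn_exp_add_sin_sub_one hu
  rw [integral_exp_add_sin_sub_one, egf_gammaCoef hper (by simp [hc])] at hm
  simp only [add_mul] at hm
  have i1 : IntegrableOn (fun s => Real.exp (-(u * s)) * ((1 - Real.exp (-s ^ 4)) / s ^ 2)) (Ioi 0) := by
    refine hk.bdd_mul (c := 1) (by fun_prop : Continuous fun s : ℝ =>
      Real.exp (-(u * s))).aestronglyMeasurable
      ((ae_restrict_iff' measurableSet_Ioi).2 (ae_of_all _ fun s hs => ?_))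
    have hs' : 0 < s := hs
    rw [Real.norm_eq_abs, abs_of_pos (Real.exp_pos _)]
    exact Real.exp_le_one_iff.2 (by nlinarith)
  have i2 : IntegrableOn (fun s => Real.sin (u * s) * ((1 - Real.exp (-s ^ 4)) / s ^ 2)) (Ioi 0) := by
    refine hk.bdd_mul (c := 1) (by fun_prop : Continuous fun s : ℝ =>
      Real.sin (u * s)).aestronglyMeasurable (ae_of_all _ fun s => ?_)
    exact Real.abs_sin_le_one _
  rw [← integral_add i1 i2, hm]
  have e : ![c 0 * Real.Gamma (-1 / 4), 0, c 2 * Real.Gamma (1 / 4), c 3 * Real.Gamma (1 / 2)] =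
      ![Real.Gamma (-1 / 4), 0, Real.Gamma (1 / 4), -2 * Real.Gamma (1 / 2)] := by
    norm_num [hc, pow_succ]
  rw [e]
  ring

/-- The reflection formula, used to match the reciprocal Gamma values in the initial data with the
Gamma values of the integral representation. -/
theorem Gamma_quarter_mul : Real.Gamma (1 / 4) * Real.Gamma (3 / 4) = Real.pi * √2 := by
  have h := Real.Gamma_mul_Gamma_one_sub (1 / 4)
  rw [show (1 : ℝ) - 1 / 4 = 3 / 4 by norm_num, show Real.pi * (1 / 4) = Real.pi / 4 by ring,
    Real.sin_pi_div_four] at h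
  rw [h]
  have h2 : √2 * √2 = (2 : ℝ) := Real.mul_self_sqrt (by norm_num)
  field_simp
  linarith

theorem Gamma_five_quarters : Real.Gamma (5 / 4) = Real.Gamma (1 / 4) / 4 := by
  have h := Real.Gamma_add_one (s := 1 / 4) (by norm_num)
  norm_num at h
  rw [h]
  ring

theorem initData_zero_sub_one : initData 0 - initData 1 =
    (1 / (Real.pi * √2)) • ((2 * Real.pi) • ![0, 1, 0, 0] +
      ![Real.Gamma (-1 / 4), 0, -Real.Gamma (1 / 4), 0]) := by
  have g1 := Gamma_ne_zero (x := 4⁻¹) (by norm_num)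
  have g2 := Gamma_ne_zero (x := 3 / 4) (by norm_num)
  have hG := Gamma_quarter_mul
  rw [one_div] at hG
  funext j
  fin_cases j
  · simp [initData, D, Gamma_neg_quarter, Gamma_five_quarters]
    field_simp
    linarith
  · simp [initData, D]
    field_simp
    ring
  · simp [initData, D]
    field_simp
    linarith
  · simp [initData, D]

theorem initData_zero_add_one : initData 0 + initData 1 =
    (-(1 / (Real.pi * √2))) • ![Real.Gamma (-1 / 4), 0, Real.Gamma (1 / 4), -2 * Real.Gamma (1 / 2)] := by
  have g1 := Gamma_ne_zero (x := 4⁻¹) (by norm_num)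
  have g2 := Gamma_ne_zero (x := 3 / 4) (by norm_num)
  have hG := Gamma_quarter_mul
  rw [one_div] at hG
  have hH : Real.Gamma 2⁻¹ * Real.Gamma 2⁻¹ = Real.pi := by
    rw [← one_div, Real.Gamma_one_half_eq, Real.mul_self_sqrt Real.pi_pos.le]
  have g3 := Gamma_ne_zero (x := 2⁻¹) (by norm_num)
  funext j
  fin_cases j
  · simp [initData, D, Gamma_neg_quarter, Gamma_five_quarters]
    field_simp
    linarith
  · simp [initData, D]
  · simp [initData, D]
    field_simp
    linarith
  · simp [initData, D]
    field_simp
    linarith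

theorem tendsto_profile_zero_atTop : Tendsto (profile (initData 0)) atTop (𝓝 0) ∧
    Tendsto (profile (initData 1)) atTop (𝓝 0) := by
  have h1 : Tendsto (profile (initData 0 - initData 1)) atTop (𝓝 0) := by
    have h := tendsto_profile_cos.const_mul (1 / (Real.pi * √2))
    rw [mul_zero] at h
    refine h.congr fun u => ?_
    rw [initData_zero_sub_one, map_smul, map_add, map_smul]
    simp only [Pi.smul_apply, Pi.add_apply, smul_eq_mul, ← z₂_eq, z₂]
  have h2 : Tendsto (profile (initData 0 + initData 1)) atTop (𝓝 0) := by
    have h := tendsto_profile_exp_add_sin.const_mul (-(1 / (Real.pi * √2)))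
    rw [mul_zero] at h
    refine h.congr fun u => ?_
    rw [initData_zero_add_one, map_smul]
    rfl
  constructor
  · have h := (h2.add h1).div_const 2
    rw [add_zero, zero_div] at h
    refine h.congr fun u => ?_
    simp only [map_add, map_sub, Pi.add_apply, Pi.sub_apply]
    ring
  · have h := (h2.sub h1).div_const 2
    rw [sub_zero, zero_div] at h
    refine h.congr fun u => ?_
    simp only [map_add, map_sub, Pi.add_apply, Pi.sub_apply]
    ring

/-! ### Reflection and growth -/

theorem coef_neg_one (v : Fin 4 → ℝ) (n : ℕ) :
    coef ![v 0, -v 1, v 2, -v 3] n = (-1) ^ n * coef v n := by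
  have h := eq_coef (a := fun n => (-1) ^ n * coef v n)
    (fun n => by simp only [coef_add_four, pow_add]; ring) n
  rw [h]
  congr 1
  funext j
  fin_cases j <;> simp [coef]; ring

theorem profile_neg (v : Fin 4 → ℝ) (u : ℝ) :
    profile v (-u) = profile ![v 0, -v 1, v 2, -v 3] u := by
  rw [profile_def, profile_def, egf, egf]
  refine tsum_congr fun n => ?_
  rw [coef_neg_one, neg_pow]
  ring

/-- The recurrence factor is negative only at `n = 0`, where it meets the nonpositive `v 0`. -/
theorem coef_nonneg {v : Fin 4 → ℝ} (h0 : v 0 ≤ 0) (hv : ∀ i, i ≠ 0 → 0 ≤ v i) :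
    ∀ n : ℕ, n ≠ 0 → 0 ≤ coef v n
  | 0, h => absurd rfl h
  | 1, _ => by rw [coef]; exact hv 1 (by decide)
  | 2, _ => by rw [coef]; exact hv 2 (by decide)
  | 3, _ => by rw [coef]; exact hv 3 (by decide)
  | n + 4, _ => by
    rw [coef]
    by_cases hn : n = 0
    · subst hn
      rw [coef]
      push_cast
      linarith
    · have : (1 : ℝ) ≤ n := by exact_mod_cast Nat.one_le_iff_ne_zero.2 hn
      exact mul_nonneg (by linarith) (coef_nonneg h0 hv n hn)

theorem le_profile {v : Fin 4 → ℝ} (h0 : v 0 ≤ 0) (hv : ∀ i, i ≠ 0 → 0 ≤ v i) {j : Fin 4}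
    (hj : j ≠ 0) {u : ℝ} (hu : 0 ≤ u) :
    v 0 + v j * (u ^ (j : ℕ) / ((j : ℕ).factorial : ℝ)) ≤ profile v u := by
  have hj' : (0 : ℕ) ≠ j := fun h => hj (Fin.ext h.symm)
  have h := (isEntire_coef v u).sum_le_tsum ({0, (j : ℕ)} : Finset ℕ) (fun n hn => by
    have hn0 : n ≠ 0 := fun h => hn (by simp [h])
    have := coef_nonneg h0 hv n hn0
    positivity)
  rw [Finset.sum_pair hj'] at h
  have e0 : coef v 0 = v 0 := by rw [coef]
  have ej : coef v (j : ℕ) = v j := by fin_cases j <;> simp [coef]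
  rw [e0, ej] at h
  simpa [profile_def, egf] using h

theorem tendsto_profile_two_atTop : Tendsto (profile (initData 2)) atTop atTop := by
  have hΓ2 := Real.Gamma_pos_of_pos (s := 3 / 4) (by norm_num)
  have hlin : Tendsto (fun u : ℝ => 1 / √2 * u) atTop atTop :=
    tendsto_id.const_mul_atTop (by positivity)
  refine tendsto_atTop_mono' _ ?_ hlin
  filter_upwards [eventually_ge_atTop 0] with u hu
  have h := le_profile (v := initData 2) (by simp [initData, D]) (fun i _ => by
    fin_cases i <;> simp [initData, D] <;> positivity) (j := 1) (by decide) hu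
  simpa [initData, D] using h

theorem tendsto_profile_three_atTop : Tendsto (profile (initData 3)) atTop atBot := by
  have hΓ1 := Real.Gamma_pos_of_pos (s := 5 / 4) (by norm_num)
  set v : Fin 4 → ℝ := ![-(1 / Real.Gamma (5 / 4)), 0, 0, 1 / √2 * (1 / Real.Gamma (1 / 2))] with hv
  have hΓ : 0 < 1 / √2 * (1 / Real.Gamma (1 / 2)) :=
    mul_pos (by positivity) (one_div_pos.2 (Real.Gamma_pos_of_pos (by norm_num)))
  -- The linear part is an exact solution, so it can be removed; the rest is minus a profile that
  -- grows at least cubically.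
  have e : initData 3 = (1 / √2) • ![0, 1, 0, 0] - v := by
    funext j
    fin_cases j <;> simp [initData, D, hv]
  set b : ℝ := 1 / √2 * (1 / Real.Gamma (1 / 2)) / 6
  have hb : 0 < b := by positivity
  have h1 : Tendsto (fun u : ℝ => u * (1 / √2 - b * u ^ 2)) atTop atBot := by
    refine tendsto_id.atTop_mul_atBot₀ ?_
    have h2 : Tendsto (fun u : ℝ => b * u ^ 2) atTop atTop :=
      (tendsto_pow_atTop two_ne_zero).const_mul_atTop hb
    exact (tendsto_atBot_add_const_left atTop (1 / √2) (tendsto_neg_atTop_atBot.comp h2)).congr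
      fun u => (sub_eq_add_neg _ _).symm
  have h2 := tendsto_atBot_add_const_right atTop (1 / Real.Gamma (5 / 4)) h1
  refine tendsto_atBot_mono' _ ?_ h2
  filter_upwards [eventually_ge_atTop 0] with u hu
  have h := le_profile (v := v) (by simp [hv]; positivity) (fun i hi => by
    fin_cases i
    · exact absurd rfl hi
    · exact le_rfl
    · exact le_rfl
    · exact hΓ.le) (j := 3) (by decide) hu
  rw [e, map_sub, map_smul]
  simp only [Pi.sub_apply, Pi.smul_apply, smul_eq_mul, ← z₂_eq, z₂]
  have e0 : v 0 = -(1 / Real.Gamma (5 / 4)) := rfl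
  have e3 : v 3 = 6 * b := by
    change 1 / √2 * (1 / Real.Gamma (1 / 2)) = 6 * (1 / √2 * (1 / Real.Gamma (1 / 2)) / 6)
    ring
  rw [e0, e3, show ((((3 : Fin 4) : ℕ).factorial : ℕ) : ℝ) = 6 by norm_num [Nat.factorial],
    show (((3 : Fin 4) : ℕ)) = 3 from rfl] at h
  nlinarith

theorem profile_initData_zero (u : ℝ) : profile (initData 0) u = -profile (initData 2) (-u) := by
  rw [profile_neg, ← Pi.neg_apply, ← map_neg]
  refine congrFun (congrArg profile (funext fun j => ?_)) u
  fin_cases j <;> simp [initData, D]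

theorem profile_initData_one (u : ℝ) : profile (initData 1) u = profile (initData 3) (-u) := by
  rw [profile_neg]
  refine congrFun (congrArg profile (funext fun j => ?_)) u
  fin_cases j <;> simp [initData, D]

theorem tendsto_profile_atBot :
    Tendsto (profile (initData 0)) atBot atBot ∧ Tendsto (profile (initData 1)) atBot atBot ∧
      Tendsto (profile (initData 2)) atBot (𝓝 0) ∧ Tendsto (profile (initData 3)) atBot (𝓝 0) := by
  refine ⟨?_, ?_, ?_, ?_⟩
  · exact (tendsto_neg_atTop_atBot.comp (tendsto_profile_two_atTop.comp
      tendsto_neg_atBot_atTop)).congr fun u => (profile_initData_zero u).symm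
  · exact (tendsto_profile_three_atTop.comp tendsto_neg_atBot_atTop).congr fun u =>
      (profile_initData_one u).symm
  · have h := (tendsto_profile_zero_atTop.1.comp tendsto_neg_atBot_atTop).neg
    rw [neg_zero] at h
    refine h.congr fun u => ?_
    simp only [Function.comp_apply]
    rw [profile_initData_zero, neg_neg, neg_neg]
  · refine (tendsto_profile_zero_atTop.2.comp tendsto_neg_atBot_atTop).congr fun u => ?_
    simp only [Function.comp_apply]
    rw [profile_initData_one, neg_neg]

/-! ### Limits as `t → 0⁺` -/

theorem tendsto_scale {B : ℝ} (hB : 0 < B) :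
    Tendsto (fun t : ℝ => (B * t) ^ (1 / 4 : ℝ)) (𝓝[>] 0) (𝓝[>] 0) := by
  refine tendsto_nhdsWithin_iff.2 ⟨?_, ?_⟩
  · have hc : Continuous fun t : ℝ => (B * t) ^ (1 / 4 : ℝ) :=
      (continuous_const.mul continuous_id).rpow_const fun _ => Or.inr (by norm_num)
    have h := hc.tendsto 0
    simp only [mul_zero] at h
    rw [Real.zero_rpow (by norm_num)] at h
    exact h.mono_left nhdsWithin_le_nhds
  · filter_upwards [self_mem_nhdsWithin] with t ht using
      Real.rpow_pos_of_pos (mul_pos hB ht) _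

theorem tendsto_y_scale {B : ℝ} (hB : 0 < B) {i : Fin 4} {x : ℝ} {l : Filter ℝ}
    (hl : Tendsto (fun q : ℝ => x / q) (𝓝[>] 0) l) (h : Tendsto (profile (initData i)) l (𝓝 0)) :
    Tendsto (fun t => y B i t x) (𝓝[>] 0) (𝓝 0) := by
  have hq := tendsto_scale hB
  have h1 := (tendsto_nhdsWithin_iff.1 hq).1.mul (h.comp (hl.comp hq))
  rw [mul_zero] at h1
  exact h1.congr fun t => (y_eq_profile B i t x).symm

theorem tendsto_div_nhdsGT_atTop {x : ℝ} (hx : 0 < x) :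
    Tendsto (fun q : ℝ => x / q) (𝓝[>] 0) atTop := by
  simpa only [div_eq_mul_inv] using tendsto_inv_nhdsGT_zero.const_mul_atTop hx

theorem tendsto_div_nhdsGT_atBot {x : ℝ} (hx : x < 0) :
    Tendsto (fun q : ℝ => x / q) (𝓝[>] 0) atBot := by
  simpa only [div_eq_mul_inv] using tendsto_inv_nhdsGT_zero.const_mul_atTop_of_neg hx

end Mullins

theorem theorem3 (B : ℝ) (hB : 0 < B) :
    -- self-similar solutions on `t > 0`, `x ≠ 0`, linearly independent there
    (∀ i, Mullins.IsSolution B {0}ᶜ (Mullins.y B i) ∧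
      Mullins.IsSelfSimilar B {0}ᶜ (Mullins.y B i)) ∧
    Mullins.LinIndepOn {0}ᶜ (Mullins.y B) ∧
    -- a fundamental set on either side of `x = 0`
    Mullins.IsFundamentalSet B (Ioi 0) (Mullins.y B) ∧
    Mullins.IsFundamentalSet B (Iio 0) (Mullins.y B) ∧
    -- behaviour as `x → ±∞`
    (∀ t, 0 < t →
      Tendsto (fun x => Mullins.y B 0 t x) atTop (𝓝 0) ∧
      Tendsto (fun x => Mullins.y B 1 t x) atTop (𝓝 0) ∧
      Tendsto (fun x => Mullins.y B 2 t x) atBot (𝓝 0) ∧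
      Tendsto (fun x => Mullins.y B 3 t x) atBot (𝓝 0) ∧
      Tendsto (fun x => Mullins.y B 0 t x) atBot atBot ∧
      Tendsto (fun x => Mullins.y B 1 t x) atBot atBot ∧
      Tendsto (fun x => Mullins.y B 2 t x) atTop atTop ∧
      Tendsto (fun x => Mullins.y B 3 t x) atTop atBot) ∧
    -- behaviour as `t → 0`
    (∀ x, 0 < x →
      Tendsto (fun t => Mullins.y B 0 t x) (𝓝[>] 0) (𝓝 0) ∧
      Tendsto (fun t => Mullins.y B 1 t x) (𝓝[>] 0) (𝓝 0)) ∧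
    (∀ x, x < 0 →
      Tendsto (fun t => Mullins.y B 2 t x) (𝓝[>] 0) (𝓝 0) ∧
      Tendsto (fun t => Mullins.y B 3 t x) (𝓝[>] 0) (𝓝 0)) := by
  open Mullins in
  obtain ⟨top0, top1⟩ := tendsto_profile_zero_atTop
  obtain ⟨bot0, bot1, bot2, bot3⟩ := tendsto_profile_atBot
  refine ⟨fun i => ⟨isSolution_y hB _ i, isSelfSimilar_y B _ i⟩,
    linIndepOn_y hB isOpen_compl_singleton (by simp [(dense_compl_singleton (0 : ℝ)).closure_eq]),
    isFundamentalSet_y hB isOpen_Ioi ordConnected_Ioi (by simp) fun x hx q hq => div_pos hx hq,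
    isFundamentalSet_y hB isOpen_Iio ordConnected_Iio (by simp)
      fun x hx q hq => div_neg_of_neg_of_pos hx hq,
    fun t ht => ?_,
    fun x hx => ⟨tendsto_y_scale hB (tendsto_div_nhdsGT_atTop hx) top0,
      tendsto_y_scale hB (tendsto_div_nhdsGT_atTop hx) top1⟩,
    fun x hx => ⟨tendsto_y_scale hB (tendsto_div_nhdsGT_atBot hx) bot2,
      tendsto_y_scale hB (tendsto_div_nhdsGT_atBot hx) bot3⟩⟩
  have hq : 0 < (B * t) ^ (1 / 4 : ℝ) := Real.rpow_pos_of_pos (mul_pos hB ht) _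
  have htop : Tendsto (fun x : ℝ => x / (B * t) ^ (1 / 4 : ℝ)) atTop atTop :=
    tendsto_id.atTop_div_const hq
  have hbot : Tendsto (fun x : ℝ => x / (B * t) ^ (1 / 4 : ℝ)) atBot atBot :=
    tendsto_id.atBot_div_const hq
  simp only [y_eq_profile]
  refine ⟨?_, ?_, ?_, ?_, (bot0.comp hbot).const_mul_atBot hq, (bot1.comp hbot).const_mul_atBot hq,
    (tendsto_profile_two_atTop.comp htop).const_mul_atTop hq,
    (tendsto_profile_three_atTop.comp htop).const_mul_atBot hq⟩
  · simpa using (top0.comp htop).const_mul ((B * t) ^ (1 / 4 : ℝ))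
  · simpa using (top1.comp htop).const_mul ((B * t) ^ (1 / 4 : ℝ))
  · simpa using (bot2.comp hbot).const_mul ((B * t) ^ (1 / 4 : ℝ))
  · simpa using (bot3.comp hbot).const_mul ((B * t) ^ (1 / 4 : ℝ))
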